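/- Let $\mathcal H=\mathcal H_0$ be a complex Hilbert space with inner product $\langle\cdot,\cdot\rangle$ and let $A$ be a (possibly unbounded) positive definite selfadjoint operator in $\mathcal H$, i.e. $\langle Au,u\rangle\ge\alpha\|u\|^2$ on $\mathcal D(A)$ for some $\alpha>0$. Put $T=A^{-1}$. For real $s$ let $A^s$ be the power defined by the spectral theorem, $\langle u,v\rangle_s=\langle A^su,A^sv\rangle$, $\|u\|_s=\|A^su\|$, and let $\mathcal H_s$ be $\mathcal D(A^s)$ with this inner product (for $s<0$, the completion of $\mathcal H$ in $\|\cdot\|_s$). Let $\lambda_1\le\dots\le\lambda_\ell$ be the $\ell$ lowest eigenvalues of $A$, counted according to multiplicity, all lying below the essential spectrum of $A$ (the spectrum without the isolated eigenvalues of finite multiplicity), with corresponding orthonormal eigenvectors $u_1,\dots,u_\ell$. Let $\mathcal G_0$ be a Hilbert space with the same elements as $\mathcal H_0$ and an equivalent norm $|\cdot|_0$, and let $M$ be a positive definite selfadjoint operator in $\mathcal G_0$ with $M^{-1}$ compact. Let $0<\mu_1\le\mu_2\le\dots\to\infty$ be all eigenvalues of $M$, counted according to multiplicity, with corresponding eigenvectors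 $q_1,q_2,\dots$ orthonormal in $\mathcal G_0$. Assume that $\mathcal D(M^{1/2})$ is continuously contained in $\mathcal D(A^{1/2})$, i.e. $\mathcal D(M^{1/2})\subset\mathcal D(A^{1/2})$ and $\|A^{1/2}v\|\le c\,|M^{1/2}v|_0$ for all $v\in\mathcal D(M^{1/2})$, with some constant $c$. Let $0\le\tau\le 1/2$ and $\sigma\ge\tau$, and suppose $u_1,\dots,u_\ell\in\mathcal D(M^\sigma)$. For each $n$ let $\Lambda_1^{(n,\tau)}\le\dots\le\Lambda_n^{(n,\tau)}$ be the eigenvalues, counted according to multiplicity, and $u_1^{(n,\tau)},\dots,u_n^{(n,\tau)}\in\operatorname{span}\{q_1,\dots,q_n\}$ corresponding eigenvectors, orthonormal in $\mathcal H_{\tau-1/2}$, produced by the Rayleigh–Ritz method in $\mathcal H_\tau$ with trial vectors $q_1,\dots,q_n$, that is, by the generalized matrix eigenvalue problem $[\langle q_i,q_k\rangle_\tau]\,x=\Lambda\,[\langle Tq_i,q_k\rangle_\tau]\,x$. (Such eigenvalues and eigenvectors exist for every $n$.) Then for each $1\le j\le\ell$, as $n\to\infty$, $$\Lambda_j^{(n,\tau)}=\lambda_j+o\!\left(\mu_{n+1}^{2\tau-2\sigma}\right),$$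 and there are eigenvectors $u_{j,n}$ of $A$ in the $\lambda_j$-eigenspace, normalized in $\mathcal H_{\tau-1/2}$, such that $$\|u_{j,n}-u_j^{(n,\tau)}\|_\tau=o\!\left(\mu_{n+1}^{\tau-\sigma}\right).$$ -/

import Mathlib

open Filter Topology Asymptotics

namespace FracRitz

noncomputable section

/-! ### Positive definite selfadjoint unbounded operators and their inverses -/

/-- A (possibly unbounded) operator `A` in a complex Hilbert space is *positive definite selfadjoint*
if it is selfadjoint (hence densely defined) and `⟨A x, x⟩ ≥ α ‖x‖²` on its domain, for some
`α > 0`. -/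
structure IsPosDefSelfAdjoint {E : Type*} [NormedAddCommGroup E] [InnerProductSpace ℂ E]
    [CompleteSpace E] (A : E →ₗ.[ℂ] E) : Prop where
  selfAdjoint : IsSelfAdjoint A
  lower_bound : ∃ α : ℝ, 0 < α ∧
    ∀ x : A.domain, α * ‖(x : E)‖ ^ 2 ≤ (inner ℂ (x : E) (A x)).re

theorem IsPosDefSelfAdjoint.norm_bound {E : Type*} [NormedAddCommGroup E] [InnerProductSpace ℂ E]
    [CompleteSpace E] {A : E →ₗ.[ℂ] E} (hA : IsPosDefSelfAdjoint A) :
    ∃ α : ℝ, 0 < α ∧ ∀ x : A.domain, α * ‖(x : E)‖ ≤ ‖A x‖ := by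
  obtain ⟨α, hα, h⟩ := hA.lower_bound
  refine ⟨α, hα, fun x => ?_⟩
  rcases eq_or_lt_of_le (norm_nonneg (x : E)) with h0 | h0
  · rw [← h0]; simp
  · have h1 := h x
    have h2 : (inner ℂ (x : E) (A x)).re ≤ ‖(x : E)‖ * ‖A x‖ :=
      (Complex.re_le_norm _).trans (norm_inner_le_norm _ _)
    nlinarith

/-- Existence of the bounded everywhere defined inverse. -/
theorem IsPosDefSelfAdjoint.exists_inverse {E : Type*} [NormedAddCommGroup E]
    [InnerProductSpace ℂ E] [CompleteSpace E] {A : E →ₗ.[ℂ] E} (hA : IsPosDefSelfAdjoint A) :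
    ∃ T : E →L[ℂ] E, ∀ x, ∃ hx : T x ∈ A.domain, A ⟨T x, hx⟩ = x := by
  obtain ⟨α, hα, hb⟩ := hA.norm_bound
  have hdense := hA.selfAdjoint.dense_domain
  have hclosed : IsClosed (A.graph : Set (E × E)) := hA.selfAdjoint.isClosed
  have hinj : Function.Injective A.toFun := by
    rw [injective_iff_map_eq_zero]
    intro x hx
    have h1 := hb x
    have h2 : A x = 0 := hx
    rw [h2, norm_zero] at h1
    have h3 : ‖(x : E)‖ = 0 := by nlinarith [norm_nonneg (x : E)]
    exact Subtype.ext (norm_eq_zero.mp h3)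
  have hrc : IsClosed (LinearMap.range A.toFun : Set E) := by
    have : CompleteSpace A.graph := hclosed.completeSpace_coe
    let f : A.graph →L[ℂ] E := (ContinuousLinearMap.snd ℂ E E).comp A.graph.subtypeL
    have hanti : AntilipschitzWith (max 1 (Real.toNNReal α⁻¹)) f := by
      refine ContinuousLinearMap.antilipschitz_of_bound f ?_
      rintro ⟨p, hp⟩
      obtain ⟨y, hy1, hy2⟩ := (A.mem_graph_iff).1 hp
      have h1 := hb y
      rw [hy1, hy2] at h1
      have h2 : ‖p.1‖ ≤ α⁻¹ * ‖p.2‖ := by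
        rw [inv_mul_eq_div, le_div_iff₀ hα]; linarith
      have hc : ((max 1 (Real.toNNReal α⁻¹) : NNReal) : ℝ) = max 1 α⁻¹ := by
        rw [NNReal.coe_max, Real.coe_toNNReal _ (by positivity)]; rfl
      rw [hc]
      change max ‖p.1‖ ‖p.2‖ ≤ max 1 α⁻¹ * ‖p.2‖
      refine max_le (h2.trans ?_) ?_
      · exact mul_le_mul_of_nonneg_right (le_max_right _ _) (norm_nonneg _)
      · exact le_mul_of_one_le_left (norm_nonneg _) (le_max_left _ _)
    have hcl := hanti.isClosed_range f.uniformContinuous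
    convert hcl using 1
    ext y
    constructor
    · rintro ⟨x, rfl⟩
      exact ⟨⟨((x : E), A x), A.mem_graph x⟩, rfl⟩
    · rintro ⟨⟨p, hp⟩, rfl⟩
      obtain ⟨y, hy1, hy2⟩ := (A.mem_graph_iff).1 hp
      exact ⟨y, hy2⟩
  have hsurj : LinearMap.range A.toFun = ⊤ := by
    have : CompleteSpace (LinearMap.range A.toFun) := hrc.completeSpace_coe
    rw [← Submodule.orthogonal_eq_bot_iff, Submodule.eq_bot_iff]
    intro y hy
    have h0 : ∀ x : A.domain, inner ℂ (0 : E) (x : E) = inner ℂ y (A x) := by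
      intro x
      rw [inner_zero_left, ← inner_conj_symm,
        (Submodule.mem_orthogonal _ _).1 hy (A x) ⟨x, rfl⟩, map_zero]
    have hmem := A.mem_adjoint_domain_of_exists y ⟨0, h0⟩
    have hval := LinearPMap.adjoint_apply_eq hdense ⟨y, hmem⟩ h0
    have hg : (y, (0 : E)) ∈ A.graph := by
      have : (y, (0 : E)) ∈ A.adjoint.graph := (LinearPMap.mem_graph_iff _).2 ⟨⟨y, hmem⟩, rfl, hval⟩
      rwa [LinearPMap.isSelfAdjoint_def.1 hA.selfAdjoint] at this
    obtain ⟨z, hz1, hz2⟩ := (A.mem_graph_iff).1 hg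
    have h1 := hb z
    simp only at hz1 hz2
    rw [hz2, hz1, norm_zero] at h1
    exact norm_eq_zero.1 (by nlinarith [norm_nonneg y])
  let φ : A.domain ≃ₗ[ℂ] E := LinearEquiv.ofBijective A.toFun ⟨hinj, LinearMap.range_eq_top.1 hsurj⟩
  have hφ : ∀ x, A (φ.symm x) = x := fun x => φ.apply_symm_apply x
  refine ⟨LinearMap.mkContinuous (A.domain.subtype ∘ₗ φ.symm.toLinearMap) α⁻¹ ?_, fun x => ?_⟩
  · intro x
    have h1 := hb (φ.symm x)
    rw [hφ] at h1
    change ‖((φ.symm x : A.domain) : E)‖ ≤ _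
    rw [inv_mul_eq_div, le_div_iff₀ hα]; linarith
  · exact ⟨(φ.symm x).2, hφ x⟩

open Classical in
/-- The bounded inverse `T = A⁻¹` (zero by convention when `A` has no bounded everywhere defined
right inverse, which does not happen for positive definite selfadjoint `A`). -/
def boundedInverse {E : Type*} [NormedAddCommGroup E] [InnerProductSpace ℂ E]
    (A : E →ₗ.[ℂ] E) : E →L[ℂ] E :=
  if h : ∃ T : E →L[ℂ] E, ∀ x, ∃ hx : T x ∈ A.domain, A ⟨T x, hx⟩ = x then h.choose else 0

theorem IsPosDefSelfAdjoint.apply_boundedInverse {E : Type*} [NormedAddCommGroup E]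
    [InnerProductSpace ℂ E] [CompleteSpace E] {A : E →ₗ.[ℂ] E} (hA : IsPosDefSelfAdjoint A)
    (x : E) : ∃ hx : boundedInverse A x ∈ A.domain, A ⟨boundedInverse A x, hx⟩ = x := by
  have h := hA.exists_inverse
  have hd : boundedInverse A = h.choose := dif_pos h
  rw [hd]
  exact h.choose_spec x

/-- Powers `A ^ s`, `s` real, of a positive definite selfadjoint operator `A`. With `T = A⁻¹`
(bounded, nonnegative, injective) and `T ^ r`, `r ≥ 0`, given by the functional calculus
(spectral theorem), `A ^ s` is the inverse of the injective operator `T ^ s`, with domain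
`range (T ^ s)`, if `s ≥ 0`, and `A ^ s = T ^ (-s)` if `s < 0`. (For `s < 0` the space `𝒟(A ^ s)` is
the completion of `E` in the norm `‖A ^ s x‖`; only its elements in `E` are considered.) -/
def fracPow {E : Type*} [NormedAddCommGroup E] [InnerProductSpace ℂ E] [CompleteSpace E]
    (A : E →ₗ.[ℂ] E) (s : ℝ) : E →ₗ.[ℂ] E :=
  if 0 ≤ s then
    (LinearMap.toPMap ((boundedInverse A ^ s : E →L[ℂ] E) : E →ₗ[ℂ] E) ⊤).inverse
  else
    LinearMap.toPMap ((boundedInverse A ^ (-s) : E →L[ℂ] E) : E →ₗ[ℂ] E) ⊤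

open Classical in
/-- The value `A ^ s x`, for `x` in the domain of `A ^ s` (and zero by convention otherwise). -/
def powApply {E : Type*} [NormedAddCommGroup E] [InnerProductSpace ℂ E] [CompleteSpace E]
    (A : E →ₗ.[ℂ] E) (s : ℝ) (x : E) : E :=
  if h : x ∈ (fracPow A s).domain then fracPow A s ⟨x, h⟩ else 0

/-- The inner product `⟨x, y⟩_s = ⟨A ^ s x, A ^ s y⟩` of the space `𝓗_s = 𝒟(A ^ s)`
(conjugate linear in `x`). -/
def powInner {E : Type*} [NormedAddCommGroup E] [InnerProductSpace ℂ E] [CompleteSpace E]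
    (A : E →ₗ.[ℂ] E) (s : ℝ) (x y : E) : ℂ :=
  inner ℂ (powApply A s x) (powApply A s y)

/-- The norm `‖x‖_s = ‖A ^ s x‖` of the space `𝓗_s = 𝒟(A ^ s)`. -/
def powNorm {E : Type*} [NormedAddCommGroup E] [InnerProductSpace ℂ E] [CompleteSpace E]
    (A : E →ₗ.[ℂ] E) (s : ℝ) (x : E) : ℝ :=
  ‖powApply A s x‖

/-! ### Spectrum -/

/-- The eigenspace `{x ∈ 𝒟(A) : A x = z x}`. -/
def eigenspace {E : Type*} [NormedAddCommGroup E] [InnerProductSpace ℂ E]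
    (A : E →ₗ.[ℂ] E) (z : ℂ) : Submodule ℂ E :=
  (LinearMap.ker (A.toFun - z • A.domain.subtype)).map A.domain.subtype

theorem mem_eigenspace_iff {E : Type*} [NormedAddCommGroup E] [InnerProductSpace ℂ E]
    (A : E →ₗ.[ℂ] E) (z : ℂ) (x : E) :
    x ∈ eigenspace A z ↔ ∃ hx : x ∈ A.domain, A ⟨x, hx⟩ = z • x := by
  constructor
  · rintro ⟨⟨y, hy⟩, h, rfl⟩
    exact ⟨hy, sub_eq_zero.1 h⟩
  · rintro ⟨hx, h⟩
    exact ⟨⟨x, hx⟩, sub_eq_zero.2 h, rfl⟩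

/-- The spectrum of `A`: the `z` for which `A - z` has no bounded everywhere defined two-sided
inverse. -/
def opSpectrum {E : Type*} [NormedAddCommGroup E] [InnerProductSpace ℂ E]
    (A : E →ₗ.[ℂ] E) : Set ℂ :=
  {z | ¬ ∃ R : E →L[ℂ] E,
    (∀ x, ∃ hx : R x ∈ A.domain, A ⟨R x, hx⟩ - z • R x = x) ∧
    ∀ x : A.domain, R (A x - z • (x : E)) = x}

/-- The essential spectrum of a selfadjoint operator: what remains of the spectrum after removal of
the isolated eigenvalues of finite multiplicity. -/
def essSpectrum {E : Type*} [NormedAddCommGroup E] [InnerProductSpace ℂ E]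
    (A : E →ₗ.[ℂ] E) : Set ℂ :=
  {z ∈ opSpectrum A | ¬ ((∃ ε : ℝ, 0 < ε ∧ ∀ w ∈ opSpectrum A, ‖w - z‖ < ε → w = z) ∧
    eigenspace A z ≠ ⊥ ∧ FiniteDimensional ℂ (eigenspace A z))}

/-- `lam 0 ≤ lam 1 ≤ … ≤ lam (ℓ - 1)` are the `ℓ` lowest eigenvalues of `A`, counted according to
multiplicity; they lie below the essential spectrum, and `u 0, …, u (ℓ - 1)` are corresponding
orthonormal eigenvectors. -/
structure IsLowestEigensystem {E : Type*} [NormedAddCommGroup E] [InnerProductSpace ℂ E]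
    (A : E →ₗ.[ℂ] E) (ℓ : ℕ) (lam : Fin ℓ → ℝ) (u : Fin ℓ → E) : Prop where
  monotone : Monotone lam
  orthonormal : Orthonormal ℂ u
  eigen : ∀ i, u i ∈ eigenspace A (lam i : ℂ)
  below_ess : ∀ i, ∀ s : ℝ, (s : ℂ) ∈ essSpectrum A → lam i < s
  lowest : ∀ (ν : ℝ) (v : E), v ∈ eigenspace A (ν : ℂ) → v ≠ 0 → (∀ i, inner ℂ (u i) v = 0) →
    ∀ i, lam i ≤ ν

/-- `mu 0 ≤ mu 1 ≤ …` are all the eigenvalues of `M`, counted according to multiplicity, with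
corresponding orthonormal eigenvectors `q 0, q 1, …`. -/
structure IsEigenEnumeration {E : Type*} [NormedAddCommGroup E] [InnerProductSpace ℂ E]
    (M : E →ₗ.[ℂ] E) (mu : ℕ → ℝ) (q : ℕ → E) : Prop where
  monotone : Monotone mu
  orthonormal : Orthonormal ℂ q
  eigen : ∀ k, q k ∈ eigenspace M (mu k : ℂ)
  exhaust : ∀ ν : ℝ, eigenspace M (ν : ℂ) ≤ Submodule.span ℂ (q '' {k | mu k = ν})

/-! ### The Rayleigh–Ritz method in `𝓗_τ` -/

/-- The matrix `[⟨w_i, w_k⟩_τ]`, `i, k < n`. -/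
def ritzLeft {E : Type*} [NormedAddCommGroup E] [InnerProductSpace ℂ E] [CompleteSpace E]
    (A : E →ₗ.[ℂ] E) (τ : ℝ) (w : ℕ → E) (n : ℕ) : Matrix (Fin n) (Fin n) ℂ :=
  Matrix.of fun i k => powInner A τ (w i) (w k)

/-- The matrix `[⟨w_i, T w_k⟩_τ]`, `i, k < n`, with `T = A⁻¹`. -/
def ritzRight {E : Type*} [NormedAddCommGroup E] [InnerProductSpace ℂ E] [CompleteSpace E]
    (A : E →ₗ.[ℂ] E) (τ : ℝ) (w : ℕ → E) (n : ℕ) : Matrix (Fin n) (Fin n) ℂ :=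
  Matrix.of fun i k => powInner A τ (w i) (boundedInverse A (w k))

/-- `Λ 0 ≤ … ≤ Λ (n - 1)` and `U 0, …, U (n - 1)` are the approximate eigenvalues and eigenvectors of
`A` that the Rayleigh–Ritz method in `𝓗_τ` produces from the trial vectors `w 0, …, w (n - 1)`:
`U i = ∑ₖ (X i)ₖ w k`, where `X i` solves the generalized matrix eigenvalue problem
`[⟨w_i, w_k⟩_τ] x = Λ [⟨w_i, T w_k⟩_τ] x` with `Λ = Λ i`, and the `U i` are orthonormal in
`𝓗_{τ - 1/2}`. As there are `n` of them, all `n` matrix eigenvalues are listed, with multiplicity.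
The values of `Λ` and `U` at indices `≥ n` are irrelevant. -/
def IsRitzSystem {E : Type*} [NormedAddCommGroup E] [InnerProductSpace ℂ E] [CompleteSpace E]
    (A : E →ₗ.[ℂ] E) (τ : ℝ) (w : ℕ → E) (n : ℕ) (Λ : ℕ → ℝ) (U : ℕ → E) : Prop :=
  (∀ i k, i ≤ k → k < n → Λ i ≤ Λ k) ∧
  (∀ i k, i < n → k < n → powInner A (τ - 1 / 2) (U i) (U k) = if i = k then 1 else 0) ∧
  ∀ i < n, ∃ X : Fin n → ℂ, U i = ∑ k : Fin n, X k • w k ∧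
    (ritzLeft A τ w n).mulVec X = (Λ i : ℂ) • (ritzRight A τ w n).mulVec X

end

end FracRitz

/-!
With `T = A⁻¹`, the substitution `U = A ^ (-τ) x` turns the Rayleigh–Ritz method in `𝓗_τ` with trial
vectors `q k` into the Rayleigh–Ritz method in `𝓗` for the bounded operator `T ≥ 0`, with trial
vectors `y k = A ^ τ (q k)` and Ritz values `θ = Λ⁻¹` (`IsRitzSystem.exists_isRitzPairs`). The norm
of `𝓗_τ` becomes the norm of `𝓗`, and the eigenvectors of `A` are mapped to multiples of themselves.
What has to be shown is then a statement on `T`, whose only inputs are the distance of the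
eigenvectors `u i` to the trial space and a spectral gap.

*The distance.* By the Heinz inequality, the continuous inclusion of `𝒟(M ^ (1 / 2))` in
`𝒟(A ^ (1 / 2))` gives a continuous inclusion of `𝒟(M ^ τ)` in `𝒟(A ^ τ)` (`exists_rpow_eq_of_fracPow_half_le`).
It rests on `re_inner_rpow_conj_le`: an inequality between the quadratic forms of two bounded
nonnegative operators, in two different spaces, passes to their powers with exponents in `[0, 1]`,
by the integral representation of the powers and a variational characterization of `T (t + T)⁻¹`. So
the distance of `u i` to the trial space is bounded by the error of the truncated expansion of `u i`
in the `q k`, measured in `𝒟(M ^ τ)`. As `u i ∈ 𝒟(M ^ σ)`, this error is `μ n ^ (τ - σ)` times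
the norm of the tail of a convergent series, hence `ε n = o(μ n ^ (τ - σ))`
(`IsEigenEnumeration.exists_approx`).

*The gap.* As the `λ i` are the lowest eigenvalues and lie below the essential spectrum, the
quadratic form of `T` on the orthogonal complement of the `u i` and of the `λ j`-eigenspace is
bounded by some `γ < λ j⁻¹` (`IsLowestEigensystem.exists_gap`): otherwise the norm of the
restriction of `T` to this complement would be an isolated point of its spectrum, hence an
eigenvalue, with an eigenvector that `IsLowestEigensystem.lowest` excludes.

*The Ritz estimates.* The min-max principle gives `0 ≤ λ j⁻¹ - θ j ≤ C ε ^ 2`. A Ritz vector is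
decomposed along the `λ j`-eigenspace, the `u i` for the other eigenvalues, and the rest. Its
components along the other `u i` are `O(ε)`, and the gap bounds the rest through the quadratic form
of `λ j⁻¹ - T`, whose value at the Ritz vector is `λ j⁻¹ - θ j = O(ε ^ 2)`. So the Ritz vector has
the distance `O(ε)` to the `λ j`-eigenspace (`IsGapAt.exists_ritz_bound`).
-/

namespace FracRitz

open ContinuousLinearMap

/-! ### Powers of a bounded nonnegative operator -/

section Powers

variable {E : Type*} [NormedAddCommGroup E] [InnerProductSpace ℂ E] {T : E →L[ℂ] E}

lemma inner_apply_of_nonneg (hT : 0 ≤ T) (x y : E) : inner ℂ (T x) y = inner ℂ x (T y) :=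
  ((nonneg_iff_isPositive T).1 hT).inner_left_eq_inner_right x y

lemma re_inner_nonneg_of_nonneg (hT : 0 ≤ T) (x : E) : 0 ≤ (inner ℂ x (T x)).re :=
  ((nonneg_iff_isPositive T).1 hT).re_inner_nonneg_right x

lemma mem_spectrum_of_apply_eq_smul {κ : ℝ} {x : E} (hx0 : x ≠ 0) (hx : T x = (κ : ℂ) • x) :
    κ ∈ spectrum ℝ T := by
  intro hu
  obtain ⟨u, hu⟩ := hu
  have h1 : (u : E →L[ℂ] E) x = 0 := by
    rw [hu]
    simp [hx, Algebra.algebraMap_eq_smul_one]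
  apply hx0
  have h2 : ((↑u⁻¹ : E →L[ℂ] E) * (u : E →L[ℂ] E)) x = x := by rw [u.inv_mul]; rfl
  rw [← h2]
  change (↑u⁻¹ : E →L[ℂ] E) ((u : E →L[ℂ] E) x) = 0
  rw [h1, map_zero]

variable [CompleteSpace E]

lemma inner_rpow_apply (T : E →L[ℂ] E) (s : ℝ) (x y : E) :
    inner ℂ ((T ^ s) x) y = inner ℂ x ((T ^ s) y) :=
  inner_apply_of_nonneg CFC.rpow_nonneg x y

lemma rpow_add_of_nonneg (hT : 0 ≤ T) {r s : ℝ} (hr : 0 ≤ r) (hs : 0 ≤ s) :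
    T ^ (r + s) = T ^ r * T ^ s := by
  rcases hr.eq_or_lt with rfl | hr
  · rw [zero_add, CFC.rpow_zero T hT, one_mul]
  rcases hs.eq_or_lt with rfl | hs
  · rw [add_zero, CFC.rpow_zero T hT, mul_one]
  · lift r to NNReal using hr.le
    lift s to NNReal using hs.le
    rw [NNReal.coe_pos] at hr hs
    rw [← NNReal.coe_add, ← CFC.nnrpow_eq_rpow hr, ← CFC.nnrpow_eq_rpow hs,
      ← CFC.nnrpow_eq_rpow (add_pos hr hs), CFC.nnrpow_add hr hs]

lemma rpow_add_apply (hT : 0 ≤ T) {r s : ℝ} (hr : 0 ≤ r) (hs : 0 ≤ s) (x : E) :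
    (T ^ (r + s)) x = (T ^ r) ((T ^ s) x) := by
  rw [rpow_add_of_nonneg hT hr hs]; rfl

lemma rpow_injective (hT : 0 ≤ T) (hinj : Function.Injective T) {s : ℝ} (hs : 0 ≤ s) :
    Function.Injective (T ^ s) := by
  have h0 : ∀ n : ℕ, Function.Injective (T ^ (n : ℝ)) := by
    intro n
    rw [CFC.rpow_natCast T n hT]
    induction n with
    | zero => exact Function.injective_id
    | succ n ih => rw [pow_succ]; exact ih.comp hinj
  obtain ⟨n, hn⟩ := exists_nat_ge s
  have h1 := h0 n
  have h2 : T ^ (n : ℝ) = T ^ ((n : ℝ) - s) * T ^ s := by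
    rw [← rpow_add_of_nonneg hT (sub_nonneg.2 hn) hs, sub_add_cancel]
  rw [h2] at h1
  exact Function.Injective.of_comp (f := T ^ ((n : ℝ) - s)) h1

/-- On an eigenvector, the continuous functional calculus acts by the value of the function at the
eigenvalue: this holds for polynomials, hence for their uniform limits. -/
lemma cfc_apply_of_apply_eq_smul (hT : IsSelfAdjoint T) {κ : ℝ} {x : E}
    (hx : T x = (κ : ℂ) • x) {f : ℝ → ℝ} (hf : ContinuousOn f (spectrum ℝ T)) :
    cfc f T x = (f κ : ℂ) • x := by
  by_cases hx0 : x = 0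
  · simp [hx0]
  have hκ : κ ∈ spectrum ℝ T := mem_spectrum_of_apply_eq_smul hx0 hx
  have key : ∀ g : C(spectrum ℝ T, ℝ), cfcHom hT g x = (g ⟨κ, hκ⟩ : ℂ) • x := by
    intro g
    induction g using ContinuousMap.induction_on_of_compact with
    | const r =>
      have : cfcHom hT (ContinuousMap.const _ r) = algebraMap ℝ (E →L[ℂ] E) r :=
        AlgHomClass.commutes (cfcHom hT) r
      rw [this, Algebra.algebraMap_eq_smul_one]
      simp
    | id => rw [cfcHom_id hT]; exact hx
    | star_id => rw [map_star, cfcHom_id, hT.star_eq]; exact hx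
    | add f g hf hg => simp [hf, hg, add_smul]
    | mul f g hf hg =>
      rw [map_mul]
      change cfcHom hT f (cfcHom hT g x) = _
      rw [hg, map_smul, hf, smul_smul]
      simp [mul_comm]
    | frequently f hf =>
      have hcl : IsClosed {g : C(spectrum ℝ T, ℝ) | cfcHom hT g x = (g ⟨κ, hκ⟩ : ℂ) • x} := by
        refine isClosed_eq ?_ ?_
        · exact (ContinuousLinearMap.apply ℂ E x).continuous.comp (cfcHom_continuous hT)
        · have : Continuous fun g : C(spectrum ℝ T, ℝ) => g ⟨κ, hκ⟩ :=
            continuous_eval_const _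
          fun_prop
      exact hcl.closure_subset (mem_closure_iff_frequently.2 hf)
  rw [cfc_apply f T hT hf, key]
  rfl

lemma rpow_apply_of_apply_eq_smul (hT : 0 ≤ T) {κ : ℝ} {x : E}
    (hx : T x = (κ : ℂ) • x) {s : ℝ} (hs : 0 ≤ s) :
    (T ^ s) x = ((κ ^ s : ℝ) : ℂ) • x := by
  rw [CFC.rpow_eq_cfc_real hT]
  exact cfc_apply_of_apply_eq_smul (IsSelfAdjoint.of_nonneg hT) hx
    (Real.continuous_rpow_const hs).continuousOn

end Powers

/-! ### Powers of a positive definite selfadjoint operator -/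

section fracPow

variable {E : Type*} [NormedAddCommGroup E] [InnerProductSpace ℂ E] [CompleteSpace E]
  {A : E →ₗ.[ℂ] E}

lemma mem_domain_fracPow_iff {s : ℝ} (hs : 0 ≤ s) (x : E) :
    x ∈ (fracPow A s).domain ↔ ∃ y, (boundedInverse A ^ s) y = x := by
  rw [fracPow, if_pos hs, LinearPMap.inverse_domain]
  constructor
  · rintro ⟨y, rfl⟩; exact ⟨y, rfl⟩
  · rintro ⟨y, rfl⟩; exact ⟨⟨y, trivial⟩, rfl⟩

lemma powApply_of_neg {s : ℝ} (hs : s < 0) (x : E) :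
    powApply A s x = (boundedInverse A ^ (-s)) x := by
  have key : ∀ (B : E →ₗ.[ℂ] E) (_ : B = LinearMap.toPMap
      ((boundedInverse A ^ (-s) : E →L[ℂ] E) : E →ₗ[ℂ] E) ⊤),
      ∃ h : x ∈ B.domain, B ⟨_, h⟩ = (boundedInverse A ^ (-s)) x := by
    rintro B rfl
    exact ⟨trivial, rfl⟩
  obtain ⟨h1, h2⟩ := key (fracPow A s) (by rw [fracPow, if_neg (not_le.2 hs)])
  rw [powApply, dif_pos h1, h2]

end fracPow

namespace IsPosDefSelfAdjoint

variable {E : Type*} [NormedAddCommGroup E] [InnerProductSpace ℂ E] [CompleteSpace E]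
  {A : E →ₗ.[ℂ] E}

lemma boundedInverse_apply_mem (hA : IsPosDefSelfAdjoint A) (x : E) :
    boundedInverse A x ∈ A.domain :=
  (hA.apply_boundedInverse x).1

lemma apply_boundedInverse_eq (hA : IsPosDefSelfAdjoint A) (x : E) :
    A ⟨boundedInverse A x, hA.boundedInverse_apply_mem x⟩ = x :=
  (hA.apply_boundedInverse x).2

lemma boundedInverse_apply (hA : IsPosDefSelfAdjoint A) (x : A.domain) :
    boundedInverse A (A x) = x := by
  obtain ⟨α, hα, hb⟩ := hA.norm_bound
  have h := hb (⟨_, hA.boundedInverse_apply_mem (A x)⟩ - x)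
  rw [LinearPMap.map_sub, hA.apply_boundedInverse_eq, sub_self, norm_zero] at h
  have h3 : ‖boundedInverse A (A x) - x‖ = 0 := by
    have := norm_nonneg (boundedInverse A (A x) - x)
    simp only [AddSubgroupClass.coe_sub] at h
    nlinarith
  exact sub_eq_zero.1 (norm_eq_zero.1 h3)

lemma boundedInverse_injective (hA : IsPosDefSelfAdjoint A) :
    Function.Injective (boundedInverse A) := by
  intro x y h
  rw [← hA.apply_boundedInverse_eq x, ← hA.apply_boundedInverse_eq y]
  congr 1
  exact Subtype.ext h

lemma boundedInverse_nonneg (hA : IsPosDefSelfAdjoint A) : 0 ≤ boundedInverse A := by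
  rw [nonneg_iff_isPositive, isPositive_iff_complex]
  intro x
  have hs : ∀ a b : A.domain, inner ℂ (A a) (b : E) = inner ℂ (a : E) (A b) := by
    intro a b
    have h := LinearPMap.adjoint_isFormalAdjoint hA.selfAdjoint.dense_domain
    rw [LinearPMap.isSelfAdjoint_def.1 hA.selfAdjoint] at h
    exact h a b
  set a : A.domain := ⟨boundedInverse A x, hA.boundedInverse_apply_mem x⟩ with ha
  have hax : A a = x := hA.apply_boundedInverse_eq x
  have h1 : inner ℂ (boundedInverse A x) x = inner ℂ (a : E) (A a) := by rw [hax]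
  obtain ⟨α, hα, hb⟩ := hA.lower_bound
  have h2 := hb a
  have h3 : (starRingEnd ℂ) (inner ℂ (a : E) (A a)) = inner ℂ (a : E) (A a) := by
    rw [inner_conj_symm, hs]
  rw [h1]
  refine ⟨Complex.conj_eq_iff_re.1 h3, le_trans (by positivity) h2⟩

lemma powApply_rpow (hA : IsPosDefSelfAdjoint A) {s : ℝ} (hs : 0 ≤ s) (y : E) :
    powApply A s ((boundedInverse A ^ s) y) = y := by
  have hmem : (boundedInverse A ^ s) y ∈ (fracPow A s).domain :=
    (mem_domain_fracPow_iff hs _).2 ⟨y, rfl⟩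
  rw [powApply, dif_pos hmem]
  have hinj := rpow_injective hA.boundedInverse_nonneg hA.boundedInverse_injective hs
  have key : ∀ (B : E →ₗ.[ℂ] E) (_ : B = (LinearMap.toPMap
      ((boundedInverse A ^ s : E →L[ℂ] E) : E →ₗ[ℂ] E) ⊤).inverse)
      (h : (boundedInverse A ^ s) y ∈ B.domain), B ⟨_, h⟩ = y := by
    rintro B rfl h
    refine LinearPMap.inverse_apply_eq ?_ (x := ⟨y, Submodule.mem_top⟩) rfl
    rw [LinearMap.ker_eq_bot']
    rintro ⟨z, hz⟩ h0
    refine Subtype.ext (hinj ?_)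
    rw [ZeroMemClass.coe_zero, map_zero]
    exact h0
  exact key _ (by rw [fracPow, if_pos hs]) hmem

lemma powApply_of_nonpos (hA : IsPosDefSelfAdjoint A) {s : ℝ} (hs : s ≤ 0) (x : E) :
    powApply A s x = (boundedInverse A ^ (-s)) x := by
  rcases hs.eq_or_lt with rfl | hs
  · have := hA.powApply_rpow le_rfl x
    rw [CFC.rpow_zero _ hA.boundedInverse_nonneg] at this
    rw [neg_zero, CFC.rpow_zero _ hA.boundedInverse_nonneg]
    exact this
  · exact powApply_of_neg hs x

lemma pos_of_mem_eigenspace (hA : IsPosDefSelfAdjoint A) {ν : ℝ} {x : E}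
    (hx : x ∈ eigenspace A (ν : ℂ)) (hx0 : x ≠ 0) : 0 < ν := by
  obtain ⟨hd, h⟩ := (mem_eigenspace_iff A _ x).1 hx
  obtain ⟨α, hα, hb⟩ := hA.lower_bound
  have h1 := hb ⟨x, hd⟩
  rw [h, inner_smul_right, inner_self_eq_norm_sq_to_K] at h1
  have h2 : ((ν : ℂ) * ((‖x‖ : ℂ) ^ 2)).re = ν * ‖x‖ ^ 2 := by
    rw [← Complex.ofReal_pow, ← Complex.ofReal_mul, Complex.ofReal_re]
  have h3 : α * ‖x‖ ^ 2 ≤ ν * ‖x‖ ^ 2 := h2 ▸ h1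
  have h4 : 0 < ‖x‖ ^ 2 := by positivity
  nlinarith [le_of_mul_le_mul_right h3 h4]

lemma boundedInverse_of_mem_eigenspace (hA : IsPosDefSelfAdjoint A) {ν : ℝ} {x : E}
    (hx : x ∈ eigenspace A (ν : ℂ)) :
    boundedInverse A x = ((ν⁻¹ : ℝ) : ℂ) • x := by
  by_cases hx0 : x = 0
  · simp [hx0]
  have hν := hA.pos_of_mem_eigenspace hx hx0
  obtain ⟨hd, h⟩ := (mem_eigenspace_iff A _ x).1 hx
  have h1 := hA.boundedInverse_apply ⟨x, hd⟩
  rw [h, map_smul] at h1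
  have h2 : (ν : ℂ) ≠ 0 := Complex.ofReal_ne_zero.2 hν.ne'
  rw [Complex.ofReal_inv, eq_inv_smul_iff₀ h2]
  exact h1

lemma mem_eigenspace_of_boundedInverse (hA : IsPosDefSelfAdjoint A) {κ : ℝ} (hκ : κ ≠ 0) {x : E}
    (hx : boundedInverse A x = (κ : ℂ) • x) : x ∈ eigenspace A ((κ⁻¹ : ℝ) : ℂ) := by
  have hκ' : (κ : ℂ) ≠ 0 := Complex.ofReal_ne_zero.2 hκ
  have h1 : boundedInverse A ((κ : ℂ)⁻¹ • x) = x := by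
    rw [map_smul, hx, smul_smul, inv_mul_cancel₀ hκ', one_smul]
  have h2 : x ∈ A.domain := h1 ▸ hA.boundedInverse_apply_mem _
  refine (mem_eigenspace_iff A _ x).2 ⟨h2, ?_⟩
  have h3 := hA.apply_boundedInverse_eq ((κ : ℂ)⁻¹ • x)
  rw [Complex.ofReal_inv, ← h3]
  congr 1
  exact Subtype.ext h1.symm

end IsPosDefSelfAdjoint

/-! ### Comparison of fractional powers of two operators -/

section Heinz

variable {H G : Type*} [NormedAddCommGroup H] [InnerProductSpace ℂ H]
  [NormedAddCommGroup G] [InnerProductSpace ℂ G]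

/-- The value at `x` of the quadratic form of `T (t + T)⁻¹`; here `k = (t + T)⁻¹ x`. -/
lemma re_inner_parallel_sum_eq {T : H →L[ℂ] H} {t : ℝ} (ht : 0 < t) {x k : H}
    (hk : (t : ℂ) • k + T k = x) :
    (inner ℂ x (T k)).re = t⁻¹ * (inner ℂ (x - T k) (T (x - T k))).re + ‖T k‖ ^ 2 := by
  have h1 : x - T k = (t : ℂ) • k := by rw [← hk]; abel
  have h2 : (inner ℂ (T k) (T k)).re = ‖T k‖ ^ 2 := by
    rw [inner_self_eq_norm_sq_to_K]; norm_cast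
  rw [h1, ← hk, inner_add_left, Complex.add_re, h2, map_smul, inner_smul_left, inner_smul_left,
    inner_smul_right, Complex.conj_ofReal, Complex.re_ofReal_mul, Complex.re_ofReal_mul,
    Complex.re_ofReal_mul, inv_mul_cancel_left₀ ht.ne']

/-- The value at `h` of the quadratic form of `S (t + S)⁻¹` is the minimum over `y` of
`t⁻¹ ⟨S (h - y), h - y⟩ + ‖y‖ ^ 2`: it is a lower bound, and by `re_inner_parallel_sum_eq` it is
attained at `y = S (t + S)⁻¹ h`. -/
lemma re_inner_parallel_sum_le {S : G →L[ℂ] G} (hS : 0 ≤ S) {t : ℝ} (ht : 0 < t) {h k : G}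
    (hk : (t : ℂ) • k + S k = h) (y : G) :
    (inner ℂ h (S k)).re ≤ t⁻¹ * (inner ℂ (h - y) (S (h - y))).re + ‖y‖ ^ 2 := by
  obtain ⟨d, rfl⟩ : ∃ d, y = S k + d := ⟨y - S k, by abel⟩
  rw [re_inner_parallel_sum_eq ht hk]
  have h1 : h - S k = (t : ℂ) • k := by rw [← hk]; abel
  have h2 : h - (S k + d) = (t : ℂ) • k - d := by rw [← h1]; abel
  have h3 : (inner ℂ ((t : ℂ) • k - d) (S ((t : ℂ) • k - d))).re =
      (inner ℂ ((t : ℂ) • k) (S ((t : ℂ) • k))).re - 2 * t * (inner ℂ (S k) d).re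
        + (inner ℂ d (S d)).re := by
    have e1 : (inner ℂ ((t : ℂ) • k) (S d)).re = t * (inner ℂ (S k) d).re := by
      rw [inner_smul_left, Complex.conj_ofReal, Complex.re_ofReal_mul, inner_apply_of_nonneg hS]
    have e2 : (inner ℂ d (S ((t : ℂ) • k))).re = t * (inner ℂ (S k) d).re := by
      rw [map_smul, inner_smul_right, Complex.re_ofReal_mul, ← inner_conj_symm, Complex.conj_re]
    rw [map_sub, inner_sub_left, inner_sub_right, inner_sub_right, Complex.sub_re, Complex.sub_re,
      Complex.sub_re, e1, e2]
    ring
  have h4 : ‖S k + d‖ ^ 2 = ‖S k‖ ^ 2 + 2 * (inner ℂ (S k) d).re + ‖d‖ ^ 2 :=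
    norm_add_sq (𝕜 := ℂ) _ _
  have h5 := mul_nonneg (inv_pos.2 ht).le (re_inner_nonneg_of_nonneg hS d)
  have h6 : t⁻¹ * (2 * t * (inner ℂ (S k) d).re) = 2 * (inner ℂ (S k) d).re := by
    field_simp
  rw [h1, h2, h3, h4, mul_add, mul_sub, h6]
  nlinarith [sq_nonneg ‖d‖]

variable [CompleteSpace H] [CompleteSpace G]

/-- The integrand in the integral representation of `a ^ p` is `t ^ (p - 1) a (t + a)⁻¹`. -/
lemma exists_resolvent_cfcₙ_rpowIntegrand {𝓐 : Type*} [CStarAlgebra 𝓐] [PartialOrder 𝓐]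
    [StarOrderedRing 𝓐] {a : 𝓐} (ha : 0 ≤ a) {p t : ℝ} (hp : p ∈ Set.Ioo (0 : ℝ) 1) (ht : 0 < t) :
    ∃ R : 𝓐, (algebraMap ℝ 𝓐 t + a) * R = 1 ∧
      cfcₙ (Real.rpowIntegrand₀₁ p t) a = t ^ (p - 1) • (a * R) := by
  have hsa : IsSelfAdjoint a := IsSelfAdjoint.of_nonneg ha
  have hspec : ∀ y ∈ spectrum ℝ a, 0 ≤ y := fun y hy => spectrum_nonneg_of_nonneg ha hy
  have hne : ∀ y ∈ spectrum ℝ a, t + y ≠ 0 := fun y hy => by have := hspec y hy; positivity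
  have hcont : ContinuousOn (fun y : ℝ => (t + y)⁻¹) (spectrum ℝ a) :=
    ContinuousOn.inv₀ (by fun_prop) hne
  refine ⟨cfc (fun y : ℝ => (t + y)⁻¹) a, ?_, ?_⟩
  · have e : algebraMap ℝ 𝓐 t + a = cfc (fun y : ℝ => t + y) a := by
      rw [cfc_const_add t (fun y => y) a, cfc_id' ℝ a]
    rw [e, ← cfc_mul _ _ a (by fun_prop) hcont, ← cfc_one ℝ a]
    exact cfc_congr fun y hy => mul_inv_cancel₀ (hne y hy)
  · have hq : ContinuousOn (Real.rpowIntegrand₀₁ p t) (quasispectrum ℝ a) :=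
      (Real.continuousOn_rpowIntegrand₀₁_Ici hp ht).mono
        fun y hy => quasispectrum_nonneg_of_nonneg a ha y hy
    have e : a * cfc (fun y : ℝ => (t + y)⁻¹) a = cfc (fun y : ℝ => y * (t + y)⁻¹) a := by
      rw [cfc_mul (fun y => y) _ a (by fun_prop) hcont, cfc_id' ℝ a]
    rw [cfcₙ_eq_cfc hq (by simp [Real.rpowIntegrand₀₁]), e,
      ← cfc_smul (t ^ (p - 1)) (fun y : ℝ => y * (t + y)⁻¹) a (continuousOn_id.mul hcont)]
    refine cfc_congr fun y hy => ?_
    simp only [Real.rpowIntegrand₀₁_eq_pow_div hp ht.le (hspec y hy), smul_eq_mul]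
    rw [mul_div_assoc, div_eq_mul_inv]

/-- The integral representation of `a ^ p` and `b ^ p`, `0 < p < 1`, with the same measure for
elements of two different C⋆-algebras. -/
lemma exists_measure_rpow_eq_integral_pair {𝓐 𝓑 : Type*} [CStarAlgebra 𝓐] [PartialOrder 𝓐]
    [StarOrderedRing 𝓐] [CStarAlgebra 𝓑] [PartialOrder 𝓑] [StarOrderedRing 𝓑] {a : 𝓐} {b : 𝓑}
    (ha : 0 ≤ a) (hb : 0 ≤ b) {p : NNReal} (hp : p ∈ Set.Ioo (0 : NNReal) 1) :
    ∃ μ : MeasureTheory.Measure ℝ,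
      MeasureTheory.IntegrableOn (fun t => cfcₙ (Real.rpowIntegrand₀₁ p t) a) (Set.Ioi 0) μ ∧
      MeasureTheory.IntegrableOn (fun t => cfcₙ (Real.rpowIntegrand₀₁ p t) b) (Set.Ioi 0) μ ∧
      a ^ (p : ℝ) = ∫ t in Set.Ioi 0, cfcₙ (Real.rpowIntegrand₀₁ p t) a ∂μ ∧
      b ^ (p : ℝ) = ∫ t in Set.Ioi 0, cfcₙ (Real.rpowIntegrand₀₁ p t) b ∂μ := by
  have hab : (0 : 𝓐 × 𝓑) ≤ (a, b) := ⟨ha, hb⟩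
  -- Both formulas are components of the integral representation in the product algebra.
  obtain ⟨μ, hμ⟩ := CFC.exists_measure_nnrpow_eq_integral_cfcₙ_rpowIntegrand₀₁ (𝓐 × 𝓑) hp
  obtain ⟨hi, he⟩ := hμ (a, b) hab
  have hc : ∀ t ∈ Set.Ioi (0 : ℝ), cfcₙ (Real.rpowIntegrand₀₁ p t) ((a, b) : 𝓐 × 𝓑) =
      (cfcₙ (Real.rpowIntegrand₀₁ p t) a, cfcₙ (Real.rpowIntegrand₀₁ p t) b) := by
    intro t ht
    refine cfcₙ_map_prod (S := ℝ) _ a b ?_ (IsSelfAdjoint.of_nonneg hab)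
      (IsSelfAdjoint.of_nonneg ha) (IsSelfAdjoint.of_nonneg hb)
    refine (Real.continuousOn_rpowIntegrand₀₁_Ici hp ht).mono ?_
    rintro y (hy | hy)
    · exact quasispectrum_nonneg_of_nonneg a ha y hy
    · exact quasispectrum_nonneg_of_nonneg b hb y hy
  rw [MeasureTheory.integrableOn_congr_fun hc measurableSet_Ioi] at hi
  rw [MeasureTheory.setIntegral_congr_fun measurableSet_Ioi hc, ← CFC.nnrpow_eq_pow,
    CFC.nnrpow_map_prod ha hb] at he
  refine ⟨μ, hi.fst, hi.snd, ?_, ?_⟩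
  · rw [← CFC.nnrpow_eq_rpow hp.1, show a ^ p = (a ^ p, b ^ p).1 from rfl, he, fst_integral hi]
  · rw [← CFC.nnrpow_eq_rpow hp.1, show b ^ p = (a ^ p, b ^ p).2 from rfl, he, snd_integral hi]

lemma exists_resolvent_cfcₙ_rpowIntegrand_apply {T : H →L[ℂ] H} (hT : 0 ≤ T) {p t : ℝ}
    (hp : p ∈ Set.Ioo (0 : ℝ) 1) (ht : 0 < t) (x : H) :
    ∃ k, (t : ℂ) • k + T k = x ∧
      cfcₙ (Real.rpowIntegrand₀₁ p t) T x = ((t ^ (p - 1) : ℝ) : ℂ) • T k := by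
  obtain ⟨R, h1, h2⟩ := exists_resolvent_cfcₙ_rpowIntegrand hT hp ht
  refine ⟨R x, ?_, ?_⟩
  · have := congrArg (fun B : H →L[ℂ] H => B x) h1
    simpa [Algebra.algebraMap_eq_smul_one] using this
  · rw [h2]
    simp

/-- If `J* J ≤ C` and `J* S J ≤ C T`, then `J* S ^ p J ≤ C T ^ p` for `0 ≤ p ≤ 1`. In the integral
representation of the powers it suffices to compare `S (t + S)⁻¹` with `T (t + T)⁻¹`. The form of
the former is a minimum over `y`; the choice `y = J (T (t + T)⁻¹ x)`, to which both hypotheses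
apply, gives the form of the latter. -/
lemma re_inner_rpow_conj_le {T : H →L[ℂ] H} {S : G →L[ℂ] G} (hT : 0 ≤ T) (hS : 0 ≤ S)
    (J : H →L[ℂ] G) {C : ℝ} (hJ : ∀ x, ‖J x‖ ^ 2 ≤ C * ‖x‖ ^ 2)
    (hC : ∀ x, (inner ℂ (J x) (S (J x))).re ≤ C * (inner ℂ x (T x)).re)
    {p : ℝ} (hp0 : 0 ≤ p) (hp1 : p ≤ 1) (x : H) :
    (inner ℂ (J x) ((S ^ p) (J x))).re ≤ C * (inner ℂ x ((T ^ p) x)).re := by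
  rcases hp0.eq_or_lt with rfl | hp0
  · rw [CFC.rpow_zero S hS, CFC.rpow_zero T hT]
    have := hJ x
    have e1 : (inner ℂ (J x) (J x)).re = ‖J x‖ ^ 2 := by
      rw [inner_self_eq_norm_sq_to_K]; norm_cast
    have e2 : (inner ℂ x x).re = ‖x‖ ^ 2 := by
      rw [inner_self_eq_norm_sq_to_K]; norm_cast
    change (inner ℂ (J x) (J x)).re ≤ C * (inner ℂ x x).re
    rwa [e1, e2]
  rcases hp1.eq_or_lt with rfl | hp1
  · rw [CFC.rpow_one S hS, CFC.rpow_one T hT]; exact hC x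
  lift p to NNReal using hp0.le
  have hp : p ∈ Set.Ioo (0 : NNReal) 1 := ⟨by exact_mod_cast hp0, by exact_mod_cast hp1⟩
  have hp' : (p : ℝ) ∈ Set.Ioo (0 : ℝ) 1 := ⟨hp0, hp1⟩
  have key : ∀ t : ℝ, 0 < t → (inner ℂ (J x) (cfcₙ (Real.rpowIntegrand₀₁ p t) S (J x))).re ≤
      C * (inner ℂ x (cfcₙ (Real.rpowIntegrand₀₁ p t) T x)).re := by
    intro t ht
    obtain ⟨k, hk, ek⟩ := exists_resolvent_cfcₙ_rpowIntegrand_apply hT hp' ht x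
    obtain ⟨l, hl, el⟩ := exists_resolvent_cfcₙ_rpowIntegrand_apply hS hp' ht (J x)
    rw [ek, el, inner_smul_right, inner_smul_right, Complex.re_ofReal_mul, Complex.re_ofReal_mul,
      mul_left_comm]
    refine mul_le_mul_of_nonneg_left ?_ (by positivity)
    have h1 := re_inner_parallel_sum_le hS ht hl (J (T k))
    have h2 := re_inner_parallel_sum_eq ht hk
    rw [← map_sub] at h1
    have h3 := mul_le_mul_of_nonneg_left (hC (x - T k)) (inv_pos.2 ht).le
    rw [h2]
    linarith [hJ (T k)]
  obtain ⟨μ, hiT, hiS, heT, heS⟩ := exists_measure_rpow_eq_integral_pair hT hS hp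
  let fT : (H →L[ℂ] H) →L[ℝ] ℝ :=
    Complex.reCLM.comp (((innerSL ℂ x).comp (ContinuousLinearMap.apply ℂ H x)).restrictScalars ℝ)
  let fS : (G →L[ℂ] G) →L[ℝ] ℝ :=
    Complex.reCLM.comp
      (((innerSL ℂ (J x)).comp (ContinuousLinearMap.apply ℂ G (J x))).restrictScalars ℝ)
  change fS (S ^ (p : ℝ)) ≤ C * fT (T ^ (p : ℝ))
  rw [heT, heS, ← fT.integral_comp_comm hiT, ← fS.integral_comp_comm hiS,
    ← MeasureTheory.integral_const_mul]
  exact MeasureTheory.setIntegral_mono_on (fS.integrable_comp hiS)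
    ((fT.integrable_comp hiT).const_mul C) measurableSet_Ioi fun t ht => key t ht

end Heinz

/-! ### The Heinz inequality for unbounded operators -/

section Interpolation

variable {H G : Type*} [NormedAddCommGroup H] [InnerProductSpace ℂ H] [CompleteSpace H]
  [NormedAddCommGroup G] [InnerProductSpace ℂ G] [CompleteSpace G]

lemma re_inner_rpow_two_mul {T : H →L[ℂ] H} (hT : 0 ≤ T) {s : ℝ} (hs : 0 ≤ s) (x : H) :
    (inner ℂ x ((T ^ (2 * s)) x)).re = ‖(T ^ s) x‖ ^ 2 := by
  rw [two_mul, rpow_add_apply hT hs hs, ← inner_rpow_apply, inner_self_eq_norm_sq_to_K]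
  norm_cast

/-- If `‖K x‖ ≤ C ‖B x‖` for all `x`, then the adjoint of `K` factors through the adjoint of `B`. -/
lemma exists_apply_eq_of_norm_le {K : H →L[ℂ] G} {B : H →L[ℂ] H} (hB : Function.Injective B)
    (hBs : ∀ x y, inner ℂ (B x) y = inner ℂ x (B y)) {C : ℝ} (hC0 : 0 ≤ C)
    (hC : ∀ x, ‖K x‖ ≤ C * ‖B x‖) (g : G) : ∃ y, B y = adjoint K g ∧ ‖y‖ ≤ C * ‖g‖ := by
  let e := LinearEquiv.ofInjective (B : H →ₗ[ℂ] H) hB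
  have he : ∀ z, B (e.symm z) = z := fun z => congrArg Subtype.val (e.apply_symm_apply z)
  let φ : LinearMap.range (B : H →ₗ[ℂ] H) →L[ℂ] ℂ :=
    LinearMap.mkContinuous (((innerSL ℂ g).comp K : H →L[ℂ] ℂ) ∘ₗ e.symm.toLinearMap)
      (C * ‖g‖) (fun z => by
        change ‖inner ℂ g (K (e.symm z))‖ ≤ _
        refine (norm_inner_le_norm _ _).trans ?_
        have h1 := hC (e.symm z)
        rw [he] at h1
        have h2 : ‖z‖ = ‖(z : H)‖ := rfl
        rw [h2]
        nlinarith [norm_nonneg g])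
  have hφ : ‖φ‖ ≤ C * ‖g‖ := LinearMap.mkContinuous_norm_le _ (by positivity) _
  obtain ⟨ψ, hψ, hn⟩ := exists_extension_norm_eq _ φ
  refine ⟨(InnerProductSpace.toDual ℂ H).symm ψ, ?_, ?_⟩
  · refine ext_inner_right ℂ fun x => ?_
    have h1 := hψ (e x)
    have h2 : ((e x : LinearMap.range (B : H →ₗ[ℂ] H)) : H) = B x := rfl
    have h3 : φ (e x) = inner ℂ g (K x) := by
      change inner ℂ g (K (e.symm (e x))) = _
      rw [e.symm_apply_apply]
    rw [hBs, InnerProductSpace.toDual_symm_apply, adjoint_inner_left, ← h3, ← h1, h2]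
  · rw [LinearIsometryEquiv.norm_map, hn]
    exact hφ

/-- The Heinz inequality: if `J` maps `𝒟(M ^ (1 / 2))` continuously into `𝒟(A ^ (1 / 2))`, then it
maps `𝒟(M ^ τ)` continuously into `𝒟(A ^ τ)`, `0 ≤ τ ≤ 1 / 2`. -/
lemma exists_rpow_eq_of_fracPow_half_le {A : H →ₗ.[ℂ] H} (hA : IsPosDefSelfAdjoint A)
    {M : G →ₗ.[ℂ] G} (hM : IsPosDefSelfAdjoint M) (J : G →L[ℂ] H)
    (hsub : ∀ v ∈ (fracPow M (1 / 2)).domain, J v ∈ (fracPow A (1 / 2)).domain)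
    (hcont : ∃ c : ℝ, ∀ v ∈ (fracPow M (1 / 2)).domain,
      powNorm A (1 / 2) (J v) ≤ c * powNorm M (1 / 2) v)
    {τ : ℝ} (hτ0 : 0 ≤ τ) (hτ : τ ≤ 1 / 2) :
    ∃ C : ℝ, 0 ≤ C ∧ ∀ g : G, ∃ y : H, (boundedInverse A ^ τ) y = J ((boundedInverse M ^ τ) g) ∧
      ‖y‖ ≤ C * ‖g‖ := by
  obtain ⟨c, hc⟩ := hcont
  set T := boundedInverse A with hTdef
  set S := boundedInverse M with hSdef
  have hT : 0 ≤ T := hA.boundedInverse_nonneg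
  have hS : 0 ≤ S := hM.boundedInverse_nonneg
  have h12 : (0 : ℝ) ≤ 1 / 2 := by norm_num
  -- the hypothesis on the square roots, dualized: `J S ^ (1 / 2) = T ^ (1 / 2) K` with `‖K‖ ≤ |c|`
  have hhalf : ∀ x, ‖(S ^ (1 / 2 : ℝ)) (adjoint J x)‖ ≤ |c| * ‖(T ^ (1 / 2 : ℝ)) x‖ := by
    intro x
    set g := (S ^ (1 / 2 : ℝ)) (adjoint J x) with hg
    have hmem : (S ^ (1 / 2 : ℝ)) g ∈ (fracPow M (1 / 2)).domain :=
      (mem_domain_fracPow_iff h12 _).2 ⟨g, rfl⟩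
    obtain ⟨y, hy⟩ := (mem_domain_fracPow_iff h12 _).1 (hsub _ hmem)
    have hny : ‖y‖ ≤ |c| * ‖g‖ := by
      have := hc _ hmem
      rw [powNorm, powNorm, hM.powApply_rpow h12, ← hy, hA.powApply_rpow h12] at this
      exact this.trans (mul_le_mul_of_nonneg_right (le_abs_self c) (norm_nonneg _))
    have h1 : ‖g‖ ^ 2 ≤ |c| * ‖g‖ * ‖(T ^ (1 / 2 : ℝ)) x‖ := by
      have e1 : inner ℂ g g = inner ℂ ((T ^ (1 / 2 : ℝ)) x) y := by
        change inner ℂ ((S ^ (1 / 2 : ℝ)) (adjoint J x)) g = _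
        rw [inner_rpow_apply, adjoint_inner_left, ← hy, ← inner_rpow_apply T]
      have e2 : ‖inner ℂ g g‖ = ‖g‖ ^ 2 := by
        rw [inner_self_eq_norm_sq_to_K]; simp
      rw [← e2, e1, mul_comm]
      exact (norm_inner_le_norm _ _).trans (mul_le_mul_of_nonneg_left hny (norm_nonneg _))
    rcases (norm_nonneg g).eq_or_lt with h0 | h0
    · rw [← h0]; positivity
    · refine le_of_mul_le_mul_left ?_ h0
      linarith
  set C : ℝ := max (|c| ^ 2) (‖adjoint J‖ ^ 2) with hCdef
  have hC1 : ∀ x, ‖adjoint J x‖ ^ 2 ≤ C * ‖x‖ ^ 2 := fun x =>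
    calc ‖adjoint J x‖ ^ 2 ≤ (‖adjoint J‖ * ‖x‖) ^ 2 := by
          gcongr; exact (adjoint J).le_opNorm x
      _ = ‖adjoint J‖ ^ 2 * ‖x‖ ^ 2 := mul_pow _ _ _
      _ ≤ C * ‖x‖ ^ 2 := mul_le_mul_of_nonneg_right (le_max_right _ _) (sq_nonneg _)
  have hC2 : ∀ x, (inner ℂ (adjoint J x) (S (adjoint J x))).re ≤ C * (inner ℂ x (T x)).re := by
    intro x
    have e1 := re_inner_rpow_two_mul hS h12 (adjoint J x)
    have e2 := re_inner_rpow_two_mul hT h12 x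
    rw [mul_one_div_cancel two_ne_zero, CFC.rpow_one S hS] at e1
    rw [mul_one_div_cancel two_ne_zero, CFC.rpow_one T hT] at e2
    rw [e1, e2]
    calc _ ≤ (|c| * ‖(T ^ (1 / 2 : ℝ)) x‖) ^ 2 := by gcongr; exact hhalf x
      _ = |c| ^ 2 * ‖(T ^ (1 / 2 : ℝ)) x‖ ^ 2 := mul_pow _ _ _
      _ ≤ _ := mul_le_mul_of_nonneg_right (le_max_left _ _) (sq_nonneg _)
  have hC0 : 0 ≤ C := (sq_nonneg _).trans (le_max_left _ _)
  refine ⟨√C, Real.sqrt_nonneg _, fun g => ?_⟩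
  have hle : ∀ x, ‖((S ^ τ).comp (adjoint J)) x‖ ≤ √C * ‖(T ^ τ) x‖ := by
    intro x
    have h1 := re_inner_rpow_conj_le hT hS (adjoint J) hC1 hC2 (p := 2 * τ) (by linarith)
      (by linarith) x
    rw [re_inner_rpow_two_mul hS hτ0, re_inner_rpow_two_mul hT hτ0] at h1
    refine le_of_sq_le_sq ?_ (by positivity)
    rw [mul_pow, Real.sq_sqrt hC0]
    exact h1
  obtain ⟨y, hy1, hy2⟩ := exists_apply_eq_of_norm_le
    (rpow_injective hT hA.boundedInverse_injective hτ0) (inner_rpow_apply T τ)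
    (Real.sqrt_nonneg C) hle g
  refine ⟨y, ?_, hy2⟩
  rw [hy1]
  refine ext_inner_right ℂ fun x => ?_
  rw [adjoint_inner_left, ContinuousLinearMap.comp_apply, ← inner_rpow_apply, adjoint_inner_right]

end Interpolation

/-! ### Eigenvector expansions for an operator with compact inverse -/

section Tail

variable {G : Type*} [NormedAddCommGroup G] [InnerProductSpace ℂ G] [CompleteSpace G]
  {M : G →ₗ.[ℂ] G} {mu : ℕ → ℝ} {q : ℕ → G}

lemma IsEigenEnumeration.mu_pos (hM : IsPosDefSelfAdjoint M) (hq : IsEigenEnumeration M mu q)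
    (k : ℕ) : 0 < mu k :=
  hM.pos_of_mem_eigenspace (hq.eigen k) (hq.orthonormal.ne_zero k)

/-- The eigenvectors of an operator with compact inverse are complete. -/
lemma IsEigenEnumeration.top_le_closure_span (hM : IsPosDefSelfAdjoint M)
    (hMc : IsCompactOperator (boundedInverse M)) (hq : IsEigenEnumeration M mu q) :
    ⊤ ≤ (Submodule.span ℂ (Set.range q)).topologicalClosure := by
  set S := boundedInverse M with hSdef
  have hS : 0 ≤ S := hM.boundedInverse_nonneg
  have hsym : S.IsSymmetric := inner_apply_of_nonneg hS
  have h1 := orthogonalComplement_iSup_eigenspaces_eq_bot hMc hsym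
  have h2 : (⨆ κ, Module.End.eigenspace (S : Module.End ℂ G) κ) ≤
      Submodule.span ℂ (Set.range q) := by
    refine iSup_le fun κ x hx => ?_
    rw [Module.End.mem_eigenspace_iff] at hx
    by_cases hx0 : x = 0
    · rw [hx0]; exact zero_mem _
    have hκ : ((κ.re : ℝ) : ℂ) = κ := Complex.conj_eq_iff_re.1
      (hsym.conj_eigenvalue_eq_self (Module.End.hasEigenvalue_of_hasEigenvector
        ⟨Module.End.mem_eigenspace_iff.2 hx, hx0⟩))
    have hx' : S x = ((κ.re : ℝ) : ℂ) • x := by rw [hκ]; exact hx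
    have hne : κ.re ≠ 0 := by
      intro h0
      rw [h0, Complex.ofReal_zero, zero_smul] at hx'
      exact hx0 (hM.boundedInverse_injective (by rw [map_zero]; exact hx'))
    exact Submodule.span_mono (Set.image_subset_range _ _)
      (hq.exhaust _ (hM.mem_eigenspace_of_boundedInverse hne hx'))
  rw [top_le_iff, Submodule.topologicalClosure_eq_top_iff, eq_bot_iff, ← h1]
  exact Submodule.orthogonal_le h2

lemma IsEigenEnumeration.rpow_apply (hM : IsPosDefSelfAdjoint M) (hq : IsEigenEnumeration M mu q)
    {s : ℝ} (hs : 0 ≤ s) (k : ℕ) :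
    (boundedInverse M ^ s) (q k) = (((mu k) ^ (-s) : ℝ) : ℂ) • q k := by
  rw [rpow_apply_of_apply_eq_smul hM.boundedInverse_nonneg
    (hM.boundedInverse_of_mem_eigenspace (hq.eigen k)) hs,
    Real.inv_rpow (hq.mu_pos hM k).le, Real.rpow_neg (hq.mu_pos hM k).le]

/-- On the orthogonal complement of the first `n` eigenvectors, `M ^ (-s)` has a norm of at most
`μ n ^ (-s)`. -/
lemma IsEigenEnumeration.norm_rpow_apply_le (hM : IsPosDefSelfAdjoint M)
    (hMc : IsCompactOperator (boundedInverse M)) (hq : IsEigenEnumeration M mu q)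
    {s : ℝ} (hs : 0 ≤ s) {n : ℕ} {x : G} (hx : ∀ k < n, inner ℂ (q k) x = 0) :
    ‖(boundedInverse M ^ s) x‖ ≤ mu n ^ (-s) * ‖x‖ := by
  let b := HilbertBasis.mk hq.orthonormal (hq.top_le_closure_span hM hMc)
  have hb : ∀ k, b k = q k := fun k => by rw [HilbertBasis.coe_mk]
  have hpars : ∀ z : G, HasSum (fun k => ‖inner ℂ (q k) z‖ ^ 2) (‖z‖ ^ 2) := by
    intro z
    have h := b.hasSum_inner_mul_inner z z
    have h' := Complex.hasSum_re h
    have e : (inner ℂ z z).re = ‖z‖ ^ 2 := by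
      rw [inner_self_eq_norm_sq_to_K]; norm_cast
    rw [e] at h'
    convert h' using 2 with k
    rw [hb, ← inner_conj_symm z (q k), Complex.conj_mul']
    norm_cast
  have hn := hq.mu_pos hM n
  have hle := hasSum_le (fun k => ?_) (hpars ((boundedInverse M ^ s) x))
    ((hpars x).mul_left ((mu n ^ (-s)) ^ 2))
  · rw [← mul_pow] at hle
    exact le_of_sq_le_sq hle (by positivity)
  · rw [← inner_rpow_apply, hq.rpow_apply hM hs, inner_smul_left, Complex.conj_ofReal, norm_mul,
      mul_pow, Complex.norm_real, Real.norm_of_nonneg (Real.rpow_nonneg (hq.mu_pos hM k).le _)]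
    rcases lt_or_ge k n with hk | hk
    · simp [hx k hk]
    · have h1 : mu k ^ (-s) ≤ mu n ^ (-s) :=
        Real.rpow_le_rpow_of_nonpos hn (hq.monotone hk) (by linarith)
      have h2 : 0 ≤ mu k ^ (-s) := Real.rpow_nonneg (hq.mu_pos hM k).le _
      gcongr

/-- The approximation of an element of `𝒟(M ^ σ)` by eigenvectors of `M`, measured in the norm of
`𝒟(M ^ τ)`: the difference is `M ^ (-τ) z`, and `z` is the quantity that is estimated. -/
lemma IsEigenEnumeration.exists_approx (hM : IsPosDefSelfAdjoint M)
    (hMc : IsCompactOperator (boundedInverse M)) (hq : IsEigenEnumeration M mu q)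
    {τ σ : ℝ} (hτ0 : 0 ≤ τ) (hσ : τ ≤ σ) {h : G} (hh : h ∈ (fracPow M σ).domain) :
    ∃ (c : ℕ → ℂ) (z : ℕ → G),
      (∀ n, (boundedInverse M ^ τ) (z n) = h - ∑ k ∈ Finset.range n, c k • q k) ∧
      z =o[atTop] fun n => mu n ^ (τ - σ) := by
  obtain ⟨g, rfl⟩ := (mem_domain_fracPow_iff (hτ0.trans hσ) _).1 hh
  let b := HilbertBasis.mk hq.orthonormal (hq.top_le_closure_span hM hMc)
  have hb : ∀ k, b k = q k := fun k => by rw [HilbertBasis.coe_mk]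
  let r : ℕ → G := fun n => g - ∑ k ∈ Finset.range n, inner ℂ (q k) g • q k
  have hr0 : Tendsto r atTop (𝓝 0) := by
    have h1 := (b.hasSum_repr g).tendsto_sum_nat
    have h2 := (tendsto_const_nhds (x := g)).sub h1
    rw [sub_self] at h2
    refine h2.congr fun n => ?_
    simp only [r, b.repr_apply_apply, hb]
  have hrq : ∀ n, ∀ k < n, inner ℂ (q k) (r n) = 0 := by
    intro n k hk
    simp only [r]
    rw [inner_sub_right, hq.orthonormal.inner_right_sum _ (Finset.mem_range.2 hk), sub_self]
  have hS := hM.boundedInverse_nonneg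
  refine ⟨fun k => ((mu k ^ (-σ) : ℝ) : ℂ) * inner ℂ (q k) g,
    fun n => (boundedInverse M ^ (σ - τ)) (r n), fun n => ?_, ?_⟩
  · rw [← rpow_add_apply hS hτ0 (sub_nonneg.2 hσ), add_sub_cancel]
    simp only [r]
    rw [map_sub, map_sum]
    congr 1
    refine Finset.sum_congr rfl fun k _ => ?_
    rw [map_smul, hq.rpow_apply hM (hτ0.trans hσ), smul_smul, mul_comm]
  · have h1 : (fun n => (boundedInverse M ^ (σ - τ)) (r n)) =O[atTop]
        fun n => mu n ^ (τ - σ) * ‖r n‖ := by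
      refine isBigO_of_le _ fun n => ?_
      have h2 := hq.norm_rpow_apply_le hM hMc (sub_nonneg.2 hσ) (hrq n)
      rw [neg_sub] at h2
      exact h2.trans (le_abs_self _)
    refine h1.trans_isLittleO ?_
    have h3 := (isLittleO_one_iff ℝ).2 (tendsto_zero_iff_norm_tendsto_zero.1 hr0)
    simpa using (isBigO_refl (fun n => mu n ^ (τ - σ)) atTop).mul_isLittleO h3

end Tail

/-! ### The gap below an eigenvalue -/

section SpectralGap

variable {E : Type*} [NormedAddCommGroup E] [InnerProductSpace ℂ E]

lemma mem_orthogonal_span_iff {V : Set E} {x : E} :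
    x ∈ (Submodule.span ℂ V)ᗮ ↔ ∀ v ∈ V, inner ℂ v x = 0 := by
  rw [Submodule.mem_orthogonal]
  refine ⟨fun h v hv => h v (Submodule.subset_span hv), fun h v hv => ?_⟩
  induction hv using Submodule.span_induction with
  | mem v hv => exact h v hv
  | zero => exact inner_zero_left _
  | add v w _ _ hv hw => rw [inner_add_left, hv, hw, add_zero]
  | smul c v _ hv => rw [inner_smul_left, hv, mul_zero]

lemma apply_mem_orthogonal_of_eigenvectors {T : E →L[ℂ] E} (hT : 0 ≤ T) {V : Set E}
    (hV : ∀ v ∈ V, ∃ κ : ℝ, T v = (κ : ℂ) • v) :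
    ∀ x ∈ (Submodule.span ℂ V)ᗮ, T x ∈ (Submodule.span ℂ V)ᗮ := by
  intro x hx
  rw [mem_orthogonal_span_iff] at hx ⊢
  intro v hv
  obtain ⟨κ, hκ⟩ := hV v hv
  rw [← inner_apply_of_nonneg hT, hκ, inner_smul_left, hx v hv, mul_zero]

variable [CompleteSpace E]

/-- An isolated point of the spectrum of a selfadjoint operator is an eigenvalue. -/
lemma exists_apply_eq_smul_of_isolated {B : E →L[ℂ] E} (hB : IsSelfAdjoint B) {m ε : ℝ}
    (hm : m ∈ spectrum ℝ B) (hε : 0 < ε) (hiso : ∀ w ∈ spectrum ℝ B, |w - m| < ε → w = m) :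
    ∃ x ≠ 0, B x = (m : ℂ) • x := by
  -- `f` is a continuous function that is the indicator function of `{m}` on the spectrum.
  set f : ℝ → ℝ := fun w => max 0 (1 - |w - m| / ε) with hf
  have hfm : f m = 1 := by simp [hf]
  have hf0 : ∀ w ∈ spectrum ℝ B, w ≠ m → f w = 0 := by
    intro w hw hne
    have h1 : ε ≤ |w - m| := by
      by_contra! h
      exact hne (hiso w hw h)
    have h2 : 1 ≤ |w - m| / ε := (one_le_div hε).2 h1
    exact max_eq_left (by linarith)
  have hfc : Continuous f := by fun_prop
  have h1 : B * cfc f B = m • cfc f B := by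
    have e1 : B * cfc f B = cfc (fun w => w * f w) B := by
      rw [cfc_mul (fun w => w) f B, cfc_id' ℝ B]
    rw [e1, ← cfc_smul m f B]
    refine cfc_congr fun w hw => ?_
    by_cases hwm : w = m
    · simp [hwm]
    · simp [hf0 w hw hwm]
  have h2 : cfc f B ≠ 0 := by
    intro h0
    rw [← cfc_zero ℝ B] at h0
    have := eqOn_of_cfc_eq_cfc h0 (hfc.continuousOn) continuousOn_const hB hm
    rw [hfm] at this
    exact one_ne_zero this
  obtain ⟨y, hy⟩ : ∃ y, cfc f B y ≠ 0 := by
    by_contra! h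
    exact h2 (ContinuousLinearMap.ext h)
  refine ⟨_, hy, ?_⟩
  have := congrArg (fun D : E →L[ℂ] E => D y) h1
  simpa using this

lemma norm_mem_spectrum_of_pos {B : E →L[ℂ] E} (hB : 0 ≤ B) (hm : 0 < ‖B‖) :
    ‖B‖ ∈ spectrum ℝ B := by
  have : Nontrivial (E →L[ℂ] E) := ⟨B, 0, fun h => hm.ne' (by rw [h, norm_zero])⟩
  exact CStarAlgebra.norm_mem_spectrum_of_nonneg hB

/-- A nonzero spectral value `w` of the restriction of `T = A⁻¹` to the orthogonal complement of a
set of eigenvectors yields the spectral value `w⁻¹` of `A`. -/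
lemma IsPosDefSelfAdjoint.inv_mem_opSpectrum {A : E →ₗ.[ℂ] E} (hA : IsPosDefSelfAdjoint A)
    {V : Set E} (hV : ∀ v ∈ V, ∃ κ : ℝ, boundedInverse A v = (κ : ℂ) • v) {w : ℝ} (hw0 : w ≠ 0)
    (hw : w ∈ spectrum ℝ ((boundedInverse A).restrict
      (apply_mem_orthogonal_of_eigenvectors hA.boundedInverse_nonneg hV))) :
    ((w⁻¹ : ℝ) : ℂ) ∈ opSpectrum A := by
  rintro ⟨R, hR1, hR2⟩
  refine hw ?_
  rw [spectrum.mem_resolventSet_iff, isUnit_iff_bijective]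
  set T := boundedInverse A with hTdef
  set z : ℂ := ((w⁻¹ : ℝ) : ℂ) with hz
  have hT := hA.boundedInverse_nonneg
  have hwz : z * (w : ℂ) = 1 := by
    rw [hz, ← Complex.ofReal_mul, inv_mul_cancel₀ hw0, Complex.ofReal_one]
  have hz0 : z ≠ 0 := left_ne_zero_of_mul_eq_one hwz
  have hRr : ∀ x, R x = T x + z • T (R x) := by
    intro x
    obtain ⟨hx, e⟩ := hR1 x
    have h1 := hA.boundedInverse_apply ⟨R x, hx⟩
    rw [sub_eq_iff_eq_add.1 e, map_add, map_smul] at h1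
    exact h1.symm
  have hRl : ∀ x, R x - z • R (T x) = T x := by
    intro x
    have h1 := hR2 ⟨T x, hA.boundedInverse_apply_mem x⟩
    rwa [hA.apply_boundedInverse_eq, map_sub, map_smul] at h1
  -- `w - T` is inverted by `z (1 + z R)`.
  have hright : ∀ x, (w : ℂ) • (z • (x + z • R x)) - T (z • (x + z • R x)) = x := by
    intro x
    rw [map_smul, map_add, map_smul, ← hRr, smul_smul, mul_comm, hwz, one_smul,
      add_sub_cancel_right]
  have hleft : ∀ x, z • (((w : ℂ) • x - T x) + z • R ((w : ℂ) • x - T x)) = x := by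
    intro x
    have h1 : z • R ((w : ℂ) • x - T x) = T x := by
      rw [map_sub, map_smul, smul_sub, smul_smul, hwz, one_smul, hRl]
    rw [h1, sub_add_cancel, smul_smul, hwz, one_smul]
  have hinj : ∀ x, (w : ℂ) • x - T x = 0 → x = 0 := by
    intro x hx
    rw [← hleft x, hx, map_zero, smul_zero, add_zero, smul_zero]
  have hcoe : ∀ x : ((Submodule.span ℂ V)ᗮ : Submodule ℂ E),
      (((algebraMap ℝ (((Submodule.span ℂ V)ᗮ : Submodule ℂ E) →L[ℂ]
        ((Submodule.span ℂ V)ᗮ : Submodule ℂ E)) w -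
        T.restrict (apply_mem_orthogonal_of_eigenvectors hT hV)) x :
          ((Submodule.span ℂ V)ᗮ : Submodule ℂ E)) : E) = (w : ℂ) • (x : E) - T x := by
    intro x
    simp [Algebra.algebraMap_eq_smul_one]
  constructor
  · rw [injective_iff_map_eq_zero]
    intro x hx
    refine Subtype.ext (hinj _ ?_)
    rw [← hcoe, hx]
    rfl
  · intro y
    have hmem : z • ((y : E) + z • R y) ∈ (Submodule.span ℂ V)ᗮ := by
      rw [mem_orthogonal_span_iff]
      intro v hv
      obtain ⟨κ, hκ⟩ := hV v hv
      set x := z • ((y : E) + z • R y) with hx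
      by_cases hwκ : w = κ
      · have : v = 0 := hinj v (by rw [hκ, hwκ, sub_self])
        rw [this, inner_zero_left]
      · have h1 : inner ℂ v ((w : ℂ) • x - T x) = 0 := by
          rw [hright]
          exact mem_orthogonal_span_iff.1 y.2 v hv
        rw [inner_sub_right, inner_smul_right, ← inner_apply_of_nonneg hT, hκ, inner_smul_left,
          Complex.conj_ofReal, ← sub_mul] at h1
        refine (mul_eq_zero.1 h1).resolve_left ?_
        rw [← Complex.ofReal_sub, Complex.ofReal_eq_zero]
        exact sub_ne_zero.2 hwκ
    refine ⟨⟨_, hmem⟩, Subtype.ext ?_⟩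
    rw [hcoe]
    exact hright y

/-- The gap at `λ_j`: on the orthogonal complement of the given eigenvectors and of the eigenspace
of `λ_j`, the numerical range of `T = A⁻¹` lies strictly below `λ_j⁻¹`. -/
lemma IsLowestEigensystem.exists_gap {A : E →ₗ.[ℂ] E} (hA : IsPosDefSelfAdjoint A) {ℓ : ℕ}
    {lam : Fin ℓ → ℝ} {u : Fin ℓ → E} (hu : IsLowestEigensystem A ℓ lam u) (j : Fin ℓ) :
    ∃ γ : ℝ, γ < (lam j)⁻¹ ∧ ∀ x, (∀ i, inner ℂ (u i) x = 0) →
      (∀ v ∈ eigenspace A (lam j : ℂ), inner ℂ v x = 0) →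
      (inner ℂ x (boundedInverse A x)).re ≤ γ * ‖x‖ ^ 2 := by
  set T := boundedInverse A with hTdef
  have hT : 0 ≤ T := hA.boundedInverse_nonneg
  have hj : 0 < lam j := hA.pos_of_mem_eigenspace (hu.eigen j) (hu.orthonormal.ne_zero j)
  set V : Set E := Set.range u ∪ (eigenspace A (lam j : ℂ) : Set E) with hVdef
  have hV : ∀ v ∈ V, ∃ κ : ℝ, T v = (κ : ℂ) • v := by
    rintro v (⟨i, rfl⟩ | hv)
    · exact ⟨_, hA.boundedInverse_of_mem_eigenspace (hu.eigen i)⟩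
    · exact ⟨_, hA.boundedInverse_of_mem_eigenspace hv⟩
  set N : Submodule ℂ E := (Submodule.span ℂ V)ᗮ with hN
  set B : N →L[ℂ] N := T.restrict (apply_mem_orthogonal_of_eigenvectors hT hV) with hB
  have hBx : ∀ x : N, (B x : E) = T x := fun x => rfl
  have hB0 : 0 ≤ B := by
    rw [nonneg_iff_isPositive, isPositive_iff_complex]
    intro x
    exact (isPositive_iff_complex T).1 ((nonneg_iff_isPositive T).1 hT) x
  refine ⟨‖B‖, ?_, fun x hx1 hx2 => ?_⟩
  · by_contra! hm
    set m := ‖B‖ with hmdef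
    have hm0 : 0 < m := (inv_pos.2 hj).trans_le hm
    have hmspec : m ∈ spectrum ℝ B := norm_mem_spectrum_of_pos hB0 hm0
    have hmA := hA.inv_mem_opSpectrum hV hm0.ne' hmspec
    have hmle : m⁻¹ ≤ lam j := inv_le_of_inv_le₀ hj hm
    have hness : ((m⁻¹ : ℝ) : ℂ) ∉ essSpectrum A := fun h =>
      absurd (hu.below_ess j _ h) (not_lt.2 hmle)
    obtain ⟨⟨ε, hε, hiso⟩, -⟩ : (∃ ε : ℝ, 0 < ε ∧ ∀ w ∈ opSpectrum A,
        ‖w - ((m⁻¹ : ℝ) : ℂ)‖ < ε → w = ((m⁻¹ : ℝ) : ℂ)) ∧ _ := by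
      by_contra h
      exact hness ⟨hmA, h⟩
    -- Inversion carries the isolation of `m⁻¹` over to `m`.
    obtain ⟨δ, hδ, hball⟩ := Metric.continuousAt_iff.1 (continuousAt_inv₀ hm0.ne') ε hε
    obtain ⟨x, hx0, hx⟩ := exists_apply_eq_smul_of_isolated (IsSelfAdjoint.of_nonneg hB0) hmspec
      (lt_min hδ hm0) (fun w hw hwm => by
        have h1 : |w - m| < δ := hwm.trans_le (min_le_left _ _)
        have h2 : |w - m| < m := hwm.trans_le (min_le_right _ _)
        have hw0 : 0 < w := by linarith [(abs_lt.1 h2).1]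
        have h3 : |w⁻¹ - m⁻¹| < ε := hball h1
        have h4 := hiso _ (hA.inv_mem_opSpectrum hV hw0.ne' hw) (by
          rw [← Complex.ofReal_sub, Complex.norm_real]; exact h3)
        exact inv_injective (Complex.ofReal_injective h4))
    have hxT : T x = (m : ℂ) • (x : E) := by rw [← hBx, hx]; rfl
    have hxe := hA.mem_eigenspace_of_boundedInverse hm0.ne' hxT
    have hxE : (x : E) ≠ 0 := fun h => hx0 (Subtype.ext h)
    have hxV := mem_orthogonal_span_iff.1 x.2
    have hle := hu.lowest _ _ hxe hxE (fun i => hxV _ (Or.inl ⟨i, rfl⟩)) j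
    rw [le_antisymm hmle hle] at hxe
    exact hxE (inner_self_eq_zero.1 (hxV _ (Or.inr hxe)))
  · have hxN : x ∈ N := by
      refine mem_orthogonal_span_iff.2 ?_
      rintro v (⟨i, rfl⟩ | hv)
      · exact hx1 i
      · exact hx2 v hv
    calc (inner ℂ x (T x)).re ≤ ‖inner ℂ x (T x)‖ := Complex.re_le_norm _
      _ ≤ ‖x‖ * ‖T x‖ := norm_inner_le_norm _ _
      _ ≤ ‖x‖ * (‖B‖ * ‖x‖) := by
          gcongr
          exact B.le_opNorm ⟨x, hxN⟩
      _ = ‖B‖ * ‖x‖ ^ 2 := by ring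

end SpectralGap

/-! ### Ritz values and Ritz vectors of a bounded operator -/

section RitzEstimates

variable {E : Type*} [NormedAddCommGroup E] [InnerProductSpace ℂ E]

instance (n : ℕ) (z : Fin n → E) :
    (Submodule.span ℂ (Set.range z)).HasOrthogonalProjection :=
  have : FiniteDimensional ℂ (Submodule.span ℂ (Set.range z)) :=
    FiniteDimensional.span_of_finite ℂ (Set.finite_range z)
  inferInstance

/-- `z 0, …, z (n - 1)` are orthonormal Ritz vectors of the bounded operator `T` in their span, with
Ritz values `θ 0 ≥ … ≥ θ (n - 1)`. -/
structure IsRitzPairs (T : E →L[ℂ] E) {n : ℕ} (θ : Fin n → ℝ) (z : Fin n → E) : Prop where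
  antitone : Antitone θ
  orthonormal : Orthonormal ℂ z
  galerkin : ∀ i k, inner ℂ (z i) (T (z k)) = if i = k then (θ k : ℂ) else 0

lemma norm_sq_sum_of_orthonormal {ι : Type*} [Fintype ι] {a : ι → E} (ha : Orthonormal ℂ a)
    (c : ι → ℂ) : ‖∑ i, c i • a i‖ ^ 2 = ∑ i, ‖c i‖ ^ 2 := by
  have h := ha.inner_sum c c Finset.univ
  rw [inner_self_eq_norm_sq_to_K] at h
  have h2 : ∀ i, (starRingEnd ℂ) (c i) * c i = ((‖c i‖ ^ 2 : ℝ) : ℂ) := fun i => by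
    rw [Complex.conj_mul']; norm_cast
  simp only [h2] at h
  rw [← Complex.ofReal_sum] at h
  exact Complex.ofReal_injective ((Complex.ofReal_pow _ _).trans h)

lemma re_inner_sum_of_diagonal {ι : Type*} [Fintype ι] [DecidableEq ι] {a : ι → E}
    {T : E →L[ℂ] E} {θ : ι → ℝ}
    (h : ∀ i k, inner ℂ (a i) (T (a k)) = if i = k then (θ k : ℂ) else 0) (c : ι → ℂ) :
    (inner ℂ (∑ i, c i • a i) (T (∑ i, c i • a i))).re = ∑ i, θ i * ‖c i‖ ^ 2 := by
  rw [map_sum, sum_inner, Complex.re_sum]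
  refine Finset.sum_congr rfl fun i _ => ?_
  rw [inner_sum, Finset.sum_eq_single i]
  · rw [map_smul, inner_smul_left, inner_smul_right, h, if_pos rfl, mul_left_comm, ← mul_assoc,
      mul_comm (c i), Complex.conj_mul']
    norm_cast
    rw [mul_comm]
  · intro k _ hk
    rw [map_smul, inner_smul_left, inner_smul_right, h, if_neg hk.symm, mul_zero, mul_zero]
  · simp

/-- Among the combinations of `j + 1` vectors there is a nontrivial one that is orthogonal to `j`
given vectors. -/
lemma exists_combination_orthogonal {j : ℕ} (a : Fin (j + 1) → E) (b : Fin j → E) :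
    ∃ c : Fin (j + 1) → ℂ, ∑ i, ‖c i‖ ^ 2 = 1 ∧ ∀ k, inner ℂ (b k) (∑ i, c i • a i) = 0 := by
  let L : (Fin (j + 1) → ℂ) →ₗ[ℂ] (Fin j → ℂ) :=
    LinearMap.pi fun k =>
      ((innerSL ℂ (b k) : E →L[ℂ] ℂ) : E →ₗ[ℂ] ℂ) ∘ₗ Fintype.linearCombination ℂ a
  have hker : LinearMap.ker L ≠ ⊥ := LinearMap.ker_ne_bot_of_finrank_lt (by simp)
  obtain ⟨d, hd, hd0⟩ := (Submodule.ne_bot_iff _).1 hker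
  have hLd : ∀ k, inner ℂ (b k) (∑ i, d i • a i) = 0 := fun k => congrFun (LinearMap.mem_ker.1 hd) k
  obtain ⟨i₀, hi₀⟩ : ∃ i, d i ≠ 0 := by
    by_contra! h
    exact hd0 (funext h)
  set s := ∑ i, ‖d i‖ ^ 2 with hs
  have hs0 : 0 < s :=
    Finset.sum_pos' (fun i _ => by positivity) ⟨i₀, Finset.mem_univ _, by positivity⟩
  refine ⟨fun i => (((√s)⁻¹ : ℝ) : ℂ) * d i, ?_, fun k => ?_⟩
  · have : ∀ i, ‖(((√s)⁻¹ : ℝ) : ℂ) * d i‖ ^ 2 = s⁻¹ * ‖d i‖ ^ 2 := by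
      intro i
      rw [norm_mul, mul_pow, Complex.norm_real, norm_inv, inv_pow, Real.norm_eq_abs, sq_abs,
        Real.sq_sqrt hs0.le]
    simp only [this]
    rw [← Finset.mul_sum, ← hs, inv_mul_cancel₀ hs0.ne']
  · simp only [mul_smul]
    rw [← Finset.smul_sum, inner_smul_right, hLd, mul_zero]

lemma norm_sum_smul_le {ι : Type*} [Fintype ι] {c : ι → ℂ} {v : ι → E} {ε : ℝ}
    (hc : ∑ i, ‖c i‖ ^ 2 = 1) (hv : ∀ i, ‖v i‖ ≤ ε) : ‖∑ i, c i • v i‖ ≤ Fintype.card ι * ε := by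
  have hci : ∀ i, ‖c i‖ ≤ 1 := by
    intro i
    have h1 : ‖c i‖ ^ 2 ≤ 1 := by
      rw [← hc]
      exact Finset.single_le_sum (f := fun i => ‖c i‖ ^ 2) (fun i _ => by positivity)
        (Finset.mem_univ i)
    exact le_of_sq_le_sq (by simpa using h1) zero_le_one
  refine (norm_sum_le _ _).trans ?_
  rw [← nsmul_eq_mul, ← Finset.card_univ]
  refine Finset.sum_le_card_nsmul _ _ _ fun i _ => ?_
  rw [norm_smul]
  calc ‖c i‖ * ‖v i‖ ≤ 1 * ‖v i‖ := by gcongr; exact hci i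
    _ ≤ ε := by rw [one_mul]; exact hv i

namespace IsRitzPairs

variable {T : E →L[ℂ] E} {n : ℕ} {θ : Fin n → ℝ} {z : Fin n → E}

lemma inner_apply (hz : IsRitzPairs T θ z) (k : Fin n) {y : E}
    (hy : y ∈ Submodule.span ℂ (Set.range z)) :
    inner ℂ y (T (z k)) = (θ k : ℂ) * inner ℂ y (z k) := by
  induction hy using Submodule.span_induction with
  | mem v hv =>
    obtain ⟨i, rfl⟩ := hv
    rw [hz.galerkin, orthonormal_iff_ite.1 hz.orthonormal]
    split_ifs <;> simp
  | zero => simp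
  | add v w _ _ hv hw => rw [inner_add_left, hv, hw, inner_add_left, mul_add]
  | smul c v _ hv => rw [inner_smul_left, hv, inner_smul_left, mul_left_comm]

lemma re_inner_self (hz : IsRitzPairs T θ z) (k : Fin n) : (inner ℂ (z k) (T (z k))).re = θ k := by
  rw [hz.galerkin, if_pos rfl, Complex.ofReal_re]

/-- If `u` is an eigenvector for `κ`, the component of a Ritz vector along `u` is controlled by the
distance of `u` to the trial space. -/
lemma norm_sub_mul_inner_le (hz : IsRitzPairs T θ z) (hT : 0 ≤ T) {u : E} {κ ε : ℝ}
    (hu : T u = (κ : ℂ) • u)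
    (hε : ‖u - (Submodule.span ℂ (Set.range z)).starProjection u‖ ≤ ε) (k : Fin n) :
    |κ - θ k| * ‖inner ℂ u (z k)‖ ≤ ‖T‖ * ε := by
  set Y := Submodule.span ℂ (Set.range z) with hY
  have hzk : z k ∈ Y := Submodule.subset_span ⟨k, rfl⟩
  have h1 : inner ℂ (u - Y.starProjection u) (z k) = 0 :=
    Submodule.inner_left_of_mem_orthogonal hzk (Y.sub_starProjection_mem_orthogonal u)
  have h2 := hz.inner_apply k (Y.starProjection_apply_mem u)
  have h3 : inner ℂ u (T (z k)) = (κ : ℂ) * inner ℂ u (z k) := by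
    rw [← inner_apply_of_nonneg hT, hu, inner_smul_left, Complex.conj_ofReal]
  have h4 : ((κ - θ k : ℝ) : ℂ) * inner ℂ u (z k) = inner ℂ (u - Y.starProjection u) (T (z k)) := by
    rw [inner_sub_left, h3, h2, Complex.ofReal_sub, sub_mul]
    rw [inner_sub_left, sub_eq_zero] at h1
    rw [h1]
  have h5 := congrArg norm h4
  rw [norm_mul, Complex.norm_real, Real.norm_eq_abs] at h5
  rw [h5]
  refine (norm_inner_le_norm _ _).trans ?_
  have h6 : ‖T (z k)‖ ≤ ‖T‖ := by
    have := T.le_opNorm (z k)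
    rwa [hz.orthonormal.1 k, mul_one] at this
  have h7 : 0 ≤ ε := (norm_nonneg _).trans hε
  rw [mul_comm]
  gcongr

/-- The upper bound of a Ritz value, by the min-max principle. -/
lemma le_of_forall_orthogonal (hz : IsRitzPairs T θ z) {j : ℕ} (hj : j < n) (b : Fin j → E) {κ : ℝ}
    (hb : ∀ x, (∀ k, inner ℂ (b k) x = 0) → (inner ℂ x (T x)).re ≤ κ * ‖x‖ ^ 2) :
    θ ⟨j, hj⟩ ≤ κ := by
  obtain ⟨c, hc, hcb⟩ :=
    exists_combination_orthogonal (fun i : Fin (j + 1) => z (Fin.castLE hj i)) b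
  have hinj : Function.Injective (Fin.castLE (m := n) hj) := Fin.castLE_injective hj
  have h1 := re_inner_sum_of_diagonal (T := T) (a := fun i : Fin (j + 1) => z (Fin.castLE hj i))
    (θ := fun i => θ (Fin.castLE hj i)) (fun i k => by
      rw [hz.galerkin]; simp only [hinj.eq_iff]) c
  have h2 := norm_sq_sum_of_orthonormal (hz.orthonormal.comp _ hinj) c
  have h3 := hb _ hcb
  simp only [Function.comp_apply] at h2
  rw [h1, h2, hc, mul_one] at h3
  refine le_trans ?_ h3
  calc θ ⟨j, hj⟩ = ∑ i, θ ⟨j, hj⟩ * ‖c i‖ ^ 2 := by rw [← Finset.mul_sum, hc, mul_one]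
    _ ≤ _ := by
      refine Finset.sum_le_sum fun i _ => mul_le_mul_of_nonneg_right (hz.antitone ?_) (sq_nonneg _)
      exact Nat.lt_succ_iff.1 i.2

/-- The lower bound of a Ritz value. The error is quadratic because `T` maps the span of the
eigenvectors into itself, so that the linear term involves two projection errors. -/
lemma sub_le_of_norm_sub_le (hz : IsRitzPairs T θ z) (hT : 0 ≤ T) {j : ℕ} (hj : j < n)
    {u : Fin (j + 1) → E} {κ : Fin (j + 1) → ℝ} (hu : Orthonormal ℂ u)
    (huT : ∀ i, T (u i) = (κ i : ℂ) • u i) {κ' : ℝ} (hκ' : ∀ i, κ' ≤ κ i) {ε : ℝ}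
    (hε : ∀ i, ‖u i - (Submodule.span ℂ (Set.range z)).starProjection (u i)‖ ≤ ε) :
    κ' - θ ⟨j, hj⟩ ≤ 2 * ((j + 1) ^ 2 * ‖T‖) * ε ^ 2 := by
  set Y := Submodule.span ℂ (Set.range z) with hY
  obtain ⟨c, hc, hcz⟩ := exists_combination_orthogonal u
    (fun k : Fin j => z (Fin.castLE hj.le k))
  set x := ∑ i, c i • u i with hx
  set y := Y.starProjection x with hy
  set w := x - y with hw
  have hε0 : 0 ≤ ε := (norm_nonneg _).trans (hε 0)
  have hyY : y ∈ Y := Y.starProjection_apply_mem x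
  have hwY : w ∈ Yᗮ := Y.sub_starProjection_mem_orthogonal x
  have hx1 : ‖x‖ ^ 2 = 1 := by rw [hx, norm_sq_sum_of_orthonormal hu, hc]
  have hzY : ∀ k, z k ∈ Y := fun k => Submodule.subset_span ⟨k, rfl⟩
  have hzw : ∀ k, inner ℂ (z k) w = 0 := fun k =>
    Submodule.inner_right_of_mem_orthogonal (hzY k) hwY
  have hθ0 : 0 ≤ θ ⟨j, hj⟩ := by
    rw [← hz.re_inner_self]; exact re_inner_nonneg_of_nonneg hT _
  -- `y` is orthogonal to the first `j` Ritz vectors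
  obtain ⟨d, hd⟩ := (Submodule.mem_span_range_iff_exists_fun ℂ).1 hyY
  have hd0 : ∀ k : Fin n, (k : ℕ) < j → d k = 0 := by
    intro k hk
    have h1 : inner ℂ (z k) x = 0 := hcz ⟨k, hk⟩
    have h2 : inner ℂ (z k) y = d k := by
      rw [← hd, hz.orthonormal.inner_right_fintype]
    have h3 := hzw k
    rw [hw, inner_sub_right, h1, h2, zero_sub, neg_eq_zero] at h3
    exact h3
  have hupper : (inner ℂ y (T y)).re ≤ θ ⟨j, hj⟩ := by
    have h1 := re_inner_sum_of_diagonal hz.galerkin d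
    have h2 := norm_sq_sum_of_orthonormal hz.orthonormal d
    rw [hd] at h1 h2
    have h3 : ‖y‖ ^ 2 ≤ 1 := by
      rw [← hx1]
      gcongr
      exact Y.norm_starProjection_apply_le x
    calc (inner ℂ y (T y)).re = ∑ k, θ k * ‖d k‖ ^ 2 := h1
      _ ≤ ∑ k, θ ⟨j, hj⟩ * ‖d k‖ ^ 2 := by
        refine Finset.sum_le_sum fun k _ => ?_
        rcases lt_or_ge (k : ℕ) j with hk | hk
        · simp [hd0 k hk]
        · exact mul_le_mul_of_nonneg_right (hz.antitone hk) (sq_nonneg _)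
      _ = θ ⟨j, hj⟩ * ‖y‖ ^ 2 := by rw [← Finset.mul_sum, h2]
      _ ≤ θ ⟨j, hj⟩ := mul_le_of_le_one_right hθ0 h3
  have hTx : T x = ∑ i, (c i * κ i) • u i := by
    rw [hx, map_sum]
    exact Finset.sum_congr rfl fun i _ => by rw [map_smul, huT, smul_smul]
  have hxx : κ' ≤ (inner ℂ x (T x)).re := by
    have h1 := re_inner_sum_of_diagonal (T := T) (a := u) (θ := κ) (fun i k => by
      rw [huT, inner_smul_right, orthonormal_iff_ite.1 hu]
      split_ifs <;> simp) c
    rw [hx, h1]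
    calc κ' = ∑ i, κ' * ‖c i‖ ^ 2 := by rw [← Finset.mul_sum, hc, mul_one]
      _ ≤ _ := Finset.sum_le_sum fun i _ => mul_le_mul_of_nonneg_right (hκ' i) (sq_nonneg _)
  have hw1 : ‖w‖ ≤ (j + 1) * ε := by
    have h1 : w = ∑ i, c i • (u i - Y.starProjection (u i)) := by
      simp only [hw, hy, hx, map_sum, map_smul, smul_sub, Finset.sum_sub_distrib]
    rw [h1]
    refine (norm_sum_smul_le hc hε).trans_eq ?_
    simp
  have hw2 : ‖T x - Y.starProjection (T x)‖ ≤ (j + 1) * (‖T‖ * ε) := by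
    have h1 : T x - Y.starProjection (T x) =
        ∑ i, c i • ((κ i : ℂ) • (u i - Y.starProjection (u i))) := by
      rw [hTx]
      simp only [map_sum, map_smul, smul_sub, Finset.sum_sub_distrib, smul_smul]
    rw [h1]
    refine (norm_sum_smul_le (ε := ‖T‖ * ε) hc fun i => ?_).trans_eq ?_
    · have h2 := T.le_opNorm (u i)
      rw [huT, norm_smul, hu.1 i, mul_one, mul_one] at h2
      rw [norm_smul]
      exact mul_le_mul h2 (hε i) (norm_nonneg _) (norm_nonneg _)
    · simp
  have hwT : (inner ℂ w (T x)).re ≤ (j + 1) * ε * ((j + 1) * (‖T‖ * ε)) := by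
    have h1 : inner ℂ w (T x) = inner ℂ w (T x - Y.starProjection (T x)) := by
      rw [inner_sub_right,
        Submodule.inner_left_of_mem_orthogonal (Y.starProjection_apply_mem _) hwY, sub_zero]
    rw [h1]
    refine (Complex.re_le_norm _).trans ((norm_inner_le_norm _ _).trans ?_)
    exact mul_le_mul hw1 hw2 (norm_nonneg _) (by positivity)
  have hexp : (inner ℂ y (T y)).re =
      (inner ℂ x (T x)).re - 2 * (inner ℂ w (T x)).re + (inner ℂ w (T w)).re := by
    have h1 : y = x - w := by rw [hw]; abel
    have h2 : (inner ℂ x (T w)).re = (inner ℂ w (T x)).re := by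
      rw [← inner_apply_of_nonneg hT, ← inner_conj_symm, Complex.conj_re]
    rw [h1, map_sub, inner_sub_left, inner_sub_right, inner_sub_right, Complex.sub_re,
      Complex.sub_re, Complex.sub_re, h2]
    ring
  have hww := re_inner_nonneg_of_nonneg hT w
  nlinarith

end IsRitzPairs

end RitzEstimates

/-! ### Error bounds at an eigenvalue with a gap -/

section Gap

variable {E : Type*} [NormedAddCommGroup E] [InnerProductSpace ℂ E]

/-- The spectral data at an eigenvalue `κ j` of a bounded operator `T ≥ 0`: orthonormal eigenvectors
`u i` for `κ i`, the eigenspace `W` of `κ j`, and a bound `γ < κ j` for the numerical range of `T`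
on the orthogonal complement of all of these. -/
structure IsGapAt (T : E →L[ℂ] E) {ℓ : ℕ} (κ : Fin ℓ → ℝ) (u : Fin ℓ → E) (j : Fin ℓ)
    (W : Submodule ℂ E) (γ : ℝ) : Prop where
  nonneg : 0 ≤ T
  antitone : Antitone κ
  orthonormal : Orthonormal ℂ u
  apply_eq : ∀ i, T (u i) = (κ i : ℂ) • u i
  apply_eq_of_mem : ∀ w ∈ W, T w = (κ j : ℂ) • w
  mem_of_eq : ∀ i, κ i = κ j → u i ∈ W
  lt : γ < κ j
  le_of_orthogonal : ∀ r, (∀ i, inner ℂ (u i) r = 0) → (∀ w ∈ W, inner ℂ w r = 0) →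
    (inner ℂ r (T r)).re ≤ γ * ‖r‖ ^ 2

namespace IsGapAt

variable {T : E →L[ℂ] E} {ℓ : ℕ} {κ : Fin ℓ → ℝ} {u : Fin ℓ → E} {j : Fin ℓ} {W : Submodule ℂ E}
  {γ : ℝ}

lemma inner_eq_zero (h : IsGapAt T κ u j W γ) {i : Fin ℓ} (hi : κ i ≠ κ j) {w : E} (hw : w ∈ W) :
    inner ℂ (u i) w = 0 := by
  have h1 := inner_apply_of_nonneg h.nonneg (u i) w
  rw [h.apply_eq, h.apply_eq_of_mem w hw, inner_smul_left, inner_smul_right, Complex.conj_ofReal,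
    ← sub_eq_zero, ← sub_mul, ← Complex.ofReal_sub, mul_eq_zero, Complex.ofReal_eq_zero] at h1
  exact h1.resolve_left (sub_ne_zero.2 hi)

/-- The orthogonal decomposition of `x` along the eigenvectors for eigenvalues different from `κ j`,
the eigenspace of `κ j`, and the rest, whose squared norm is `ρ`. -/
lemma exists_decomposition (h : IsGapAt T κ u j W γ) [W.HasOrthogonalProjection] (x : E) :
    ∃ e ∈ W, ∃ ρ : ℝ, 0 ≤ ρ ∧
      ‖x - e‖ ^ 2 = ∑ i, ‖if κ i ≠ κ j then inner ℂ (u i) x else 0‖ ^ 2 + ρ ∧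
      ∑ i, (κ j - κ i) * ‖if κ i ≠ κ j then inner ℂ (u i) x else 0‖ ^ 2 + (κ j - γ) * ρ ≤
        κ j * ‖x‖ ^ 2 - (inner ℂ x (T x)).re := by
  set c : Fin ℓ → ℂ := fun i => if κ i ≠ κ j then inner ℂ (u i) x else 0 with hc
  set s := ∑ i, c i • u i with hs
  set e := W.starProjection x with he
  set r := x - s - e with hr
  have heW : e ∈ W := W.starProjection_apply_mem x
  have hWs : ∀ w ∈ W, inner ℂ w s = 0 := by
    intro w hw
    rw [hs, inner_sum]
    refine Finset.sum_eq_zero fun i _ => ?_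
    rw [inner_smul_right]
    by_cases hi : κ i = κ j
    · simp [hc, hi]
    · rw [← inner_conj_symm, h.inner_eq_zero hi hw, map_zero, mul_zero]
  have hWr : ∀ w ∈ W, inner ℂ w r = 0 := by
    intro w hw
    have h1 : r = (x - e) - s := by rw [hr]; abel
    rw [h1, inner_sub_right, hWs w hw, sub_zero]
    exact Submodule.inner_right_of_mem_orthogonal hw (W.sub_starProjection_mem_orthogonal x)
  have hur : ∀ i, inner ℂ (u i) r = 0 := by
    intro i
    by_cases hi : κ i = κ j
    · exact hWr _ (h.mem_of_eq i hi)
    · have h1 : c i = inner ℂ (u i) x := if_pos hi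
      rw [hr, inner_sub_right, inner_sub_right, h.inner_eq_zero hi heW, hs,
        h.orthonormal.inner_right_fintype, h1, sub_self, sub_zero]
  have hT := h.nonneg
  have hxe : x - e = s + r := by rw [hr]; abel
  have hrs : inner ℂ r s = 0 := by
    rw [hs, inner_sum]
    exact Finset.sum_eq_zero fun i _ => by
      rw [inner_smul_right, ← inner_conj_symm, hur, map_zero, mul_zero]
  have hrTs : inner ℂ r (T s) = 0 := by
    rw [hs, map_sum, inner_sum]
    exact Finset.sum_eq_zero fun i _ => by
      rw [map_smul, h.apply_eq, inner_smul_right, inner_smul_right, ← inner_conj_symm, hur,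
        map_zero, mul_zero, mul_zero]
  have hsr : inner ℂ s r = 0 := by rw [← inner_conj_symm, hrs, map_zero]
  have hn1 : ‖s‖ ^ 2 = ∑ i, ‖c i‖ ^ 2 := norm_sq_sum_of_orthonormal h.orthonormal c
  have hn2 : ‖x - e‖ ^ 2 = ‖s‖ ^ 2 + ‖r‖ ^ 2 := by
    rw [hxe, norm_add_sq (𝕜 := ℂ), hsr]
    simp
  have hq1 : (inner ℂ s (T s)).re = ∑ i, κ i * ‖c i‖ ^ 2 :=
    re_inner_sum_of_diagonal (fun i k => by
      rw [h.apply_eq, inner_smul_right, orthonormal_iff_ite.1 h.orthonormal]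
      split_ifs <;> simp) c
  have hq2 : (inner ℂ (s + r) (T (s + r))).re = (inner ℂ s (T s)).re + (inner ℂ r (T r)).re := by
    have h1 : inner ℂ s (T r) = 0 := by
      rw [← inner_apply_of_nonneg hT, ← inner_conj_symm, hrTs, map_zero]
    rw [map_add, inner_add_left, inner_add_right, inner_add_right, h1, hrTs]
    simp
  -- the component `e` does not contribute to the quadratic form of `κ j - T`
  have hq3 : κ j * ‖x‖ ^ 2 - (inner ℂ x (T x)).re =
      κ j * ‖s + r‖ ^ 2 - (inner ℂ (s + r) (T (s + r))).re := by
    have h1 : x = e + (s + r) := by rw [← hxe]; abel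
    have h2 : inner ℂ e (s + r) = 0 := by
      rw [inner_add_right, hWs e heW, hWr e heW, add_zero]
    have h3 : inner ℂ (s + r) e = 0 := by rw [← inner_conj_symm, h2, map_zero]
    have h4 : inner ℂ e (T (s + r)) = 0 := by
      rw [← inner_apply_of_nonneg hT, h.apply_eq_of_mem e heW, inner_smul_left, h2, mul_zero]
    have h5 : (inner ℂ e (T e)).re = κ j * ‖e‖ ^ 2 := by
      have h7 : (inner ℂ e e).re = ‖e‖ ^ 2 := by rw [inner_self_eq_norm_sq_to_K]; norm_cast
      rw [h.apply_eq_of_mem e heW, inner_smul_right, Complex.re_ofReal_mul, h7]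
    have h6 : inner ℂ (s + r) (T e) = 0 := by
      rw [h.apply_eq_of_mem e heW, inner_smul_right, h3, mul_zero]
    conv_lhs => rw [h1]
    rw [norm_add_sq (𝕜 := ℂ) e, h2, map_add T e, inner_add_left, inner_add_right e,
      inner_add_right (s + r), h4, h6, Complex.add_re, add_zero, zero_add, h5]
    simp only [map_zero]
    ring
  refine ⟨e, heW, ‖r‖ ^ 2, sq_nonneg _, by rw [hn2, hn1], ?_⟩
  rw [hq3, hq2, hq1, ← hxe, hn2, hn1]
  have h1 := h.le_of_orthogonal r hur hWr
  have h2 : ∑ i, (κ j - κ i) * ‖c i‖ ^ 2 = κ j * ∑ i, ‖c i‖ ^ 2 - ∑ i, κ i * ‖c i‖ ^ 2 := by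
    rw [Finset.mul_sum, ← Finset.sum_sub_distrib]
    exact Finset.sum_congr rfl fun i _ => sub_mul _ _ _
  rw [h2]
  linarith

/-- On the orthogonal complement of the first `j` eigenvectors, the form of `T` is bounded by `κ j`.
-/
lemma re_inner_le (h : IsGapAt T κ u j W γ) [W.HasOrthogonalProjection] {x : E}
    (hx : ∀ i < j, inner ℂ (u i) x = 0) : (inner ℂ x (T x)).re ≤ κ j * ‖x‖ ^ 2 := by
  obtain ⟨e, -, ρ, hρ, -, hle⟩ := h.exists_decomposition x
  have h1 : 0 ≤ ∑ i, (κ j - κ i) * ‖if κ i ≠ κ j then inner ℂ (u i) x else 0‖ ^ 2 := by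
    refine Finset.sum_nonneg fun i _ => ?_
    rcases lt_or_ge i j with hi | hi
    · simp [hx i hi]
    · exact mul_nonneg (sub_nonneg.2 (h.antitone hi)) (sq_nonneg _)
  have h2 := mul_nonneg (sub_nonneg.2 h.lt.le) hρ
  linarith

lemma abs_le_norm (h : IsGapAt T κ u j W γ) (i : Fin ℓ) : |κ i| ≤ ‖T‖ := by
  have h1 := T.le_opNorm (u i)
  rwa [h.apply_eq, norm_smul, h.orthonormal.1 i, mul_one, mul_one, Complex.norm_real] at h1

/-- There is a positive `η` of at most half the distance of `κ j` to the values different from it.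
-/
lemma exists_separation (κ : Fin ℓ → ℝ) (j : Fin ℓ) :
    ∃ η : ℝ, 0 < η ∧ ∀ i, κ i ≠ κ j → 2 * η ≤ |κ i - κ j| := by
  have h1 : ∀ i, ∀ᶠ η : ℝ in 𝓝[>] 0, κ i ≠ κ j → 2 * η ≤ |κ i - κ j| := by
    intro i
    by_cases hi : κ i = κ j
    · exact Eventually.of_forall fun η h => absurd hi h
    · have h2 : (0 : ℝ) < |κ i - κ j| / 2 := half_pos (abs_pos.2 (sub_ne_zero.2 hi))
      filter_upwards [nhdsWithin_le_nhds (Iio_mem_nhds h2)] with η hη _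
      have : η < |κ i - κ j| / 2 := hη
      linarith
  obtain ⟨η, hη, hη0⟩ := ((eventually_all.2 h1).and self_mem_nhdsWithin).exists
  exact ⟨η, hη0, hη⟩

/-- Error bounds for the `j`-th Ritz pair in terms of the distance `ε` of the eigenvectors `u i` to
the trial space: the Ritz value has an error `O(ε ^ 2)` and approximates from below, the Ritz vector
has the distance `O(ε)` to the eigenspace. -/
lemma exists_ritz_bound (h : IsGapAt T κ u j W γ) [W.HasOrthogonalProjection] :
    ∃ C δ : ℝ, 0 < δ ∧ ∀ (n : ℕ) (θ : Fin n → ℝ) (z : Fin n → E) (hj : (j : ℕ) < n) (ε : ℝ),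
      IsRitzPairs T θ z → ε ≤ δ →
      (∀ i, ∃ y ∈ Submodule.span ℂ (Set.range z), ‖u i - y‖ ≤ ε) →
      θ ⟨j, hj⟩ ≤ κ j ∧ κ j - θ ⟨j, hj⟩ ≤ C * ε ^ 2 ∧ ∃ e ∈ W, ‖z ⟨j, hj⟩ - e‖ ≤ C * ε := by
  obtain ⟨η, hη, hsep⟩ := exists_separation κ j
  set K : ℝ := 2 * (((j : ℕ) + 1) ^ 2 * ‖T‖) with hK
  have hK0 : 0 ≤ K := by positivity
  have hgap : 0 < κ j - γ := sub_pos.2 h.lt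
  set b : ℝ := (‖T‖ / η) ^ 2 with hb
  set D : ℝ := ℓ * b + (K + ℓ * (2 * ‖T‖ * b)) / (κ j - γ) with hD
  have hD0 : 0 ≤ D := by positivity
  refine ⟨K + √D, min 1 (η / (K + 1)), lt_min one_pos (by positivity),
    fun n θ z hj ε hz hεδ hdist => ?_⟩
  set Y := Submodule.span ℂ (Set.range z) with hY
  have hproj : ∀ i, ‖u i - Y.starProjection (u i)‖ ≤ ε := by
    intro i
    obtain ⟨y, hy, hyε⟩ := hdist i
    rw [Submodule.starProjection_minimal]
    exact (ciInf_le ⟨0, by rintro _ ⟨w, rfl⟩; exact norm_nonneg _⟩ (⟨y, hy⟩ : Y)).trans hyε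
  have hε0 : 0 ≤ ε := (norm_nonneg _).trans (hproj j)
  -- only the eigenvectors `u i` with `i < j` enter the min-max principle
  have hup : θ ⟨j, hj⟩ ≤ κ j :=
    hz.le_of_forall_orthogonal hj (fun k : Fin j => u ⟨k, k.2.trans j.2⟩) fun x hx =>
      h.re_inner_le fun i hi => hx ⟨i, hi⟩
  have hlow : κ j - θ ⟨j, hj⟩ ≤ K * ε ^ 2 :=
    hz.sub_le_of_norm_sub_le h.nonneg hj
      (h.orthonormal.comp (Fin.castLE j.2) (Fin.castLE_injective _)) (fun i => h.apply_eq _)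
      (κ' := κ j) (fun i => h.antitone (Nat.lt_succ_iff.1 i.2)) (fun i => hproj _)
  have hε1 : ε ≤ 1 := hεδ.trans (min_le_left _ _)
  have hKη : K * ε ^ 2 ≤ η := by
    have h1 : ε * (K + 1) ≤ η := (le_div_iff₀ (by positivity)).1 (hεδ.trans (min_le_right _ _))
    nlinarith [mul_nonneg hK0 hε0]
  -- the components of the Ritz vector along eigenvectors for other eigenvalues
  have hcoef : ∀ i, ‖if κ i ≠ κ j then inner ℂ (u i) (z ⟨j, hj⟩) else 0‖ ^ 2 ≤ b * ε ^ 2 := by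
    intro i
    by_cases hi : κ i = κ j
    · rw [if_neg (not_not.2 hi), norm_zero, zero_pow two_ne_zero]; positivity
    · rw [if_pos hi]
      have h1 := hz.norm_sub_mul_inner_le h.nonneg (h.apply_eq i) (hproj i) ⟨j, hj⟩
      have h2 : η ≤ |κ i - θ ⟨j, hj⟩| := by
        have h3 := hsep i hi
        have h4 : |κ i - κ j| ≤ |κ i - θ ⟨j, hj⟩| + |κ j - θ ⟨j, hj⟩| := by
          rw [abs_sub_comm (κ j)]; exact abs_sub_le _ _ _
        rw [abs_of_nonneg (sub_nonneg.2 hup)] at h4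
        linarith
      have h3 : ‖(inner ℂ (u i) (z ⟨j, hj⟩) : ℂ)‖ ≤ ‖T‖ / η * ε := by
        rw [div_mul_eq_mul_div, le_div_iff₀ hη, mul_comm]
        exact (mul_le_mul_of_nonneg_right h2 (norm_nonneg _)).trans h1
      rw [hb, ← mul_pow]
      gcongr
  obtain ⟨e, heW, ρ, hρ, hnorm, hle⟩ := h.exists_decomposition (z ⟨j, hj⟩)
  rw [hz.re_inner_self, hz.orthonormal.1, one_pow, mul_one] at hle
  have hsum : ∑ i, ‖if κ i ≠ κ j then inner ℂ (u i) (z ⟨j, hj⟩) else 0‖ ^ 2 ≤ ℓ * (b * ε ^ 2) := by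
    refine (Finset.sum_le_card_nsmul _ _ _ fun i _ => hcoef i).trans_eq ?_
    simp
  have hsum2 : -(∑ i, (κ j - κ i) * ‖if κ i ≠ κ j then inner ℂ (u i) (z ⟨j, hj⟩) else 0‖ ^ 2) ≤
      ℓ * (2 * ‖T‖ * (b * ε ^ 2)) := by
    rw [← Finset.sum_neg_distrib]
    refine (Finset.sum_le_card_nsmul _ _ (2 * ‖T‖ * (b * ε ^ 2)) fun i _ => ?_).trans_eq (by simp)
    rw [← neg_mul]
    have h1 := abs_le.1 (h.abs_le_norm i)
    have h2 := abs_le.1 (h.abs_le_norm j)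
    have h3 : -(κ j - κ i) ≤ 2 * ‖T‖ := by linarith
    refine (mul_le_mul_of_nonneg_right h3 (sq_nonneg _)).trans ?_
    exact mul_le_mul_of_nonneg_left (hcoef i) (by positivity)
  have hρle : ρ ≤ (K + ℓ * (2 * ‖T‖ * b)) / (κ j - γ) * ε ^ 2 := by
    rw [div_mul_eq_mul_div, le_div_iff₀ hgap]
    nlinarith
  have hfin : ‖z ⟨j, hj⟩ - e‖ ^ 2 ≤ (√D * ε) ^ 2 := by
    rw [mul_pow, Real.sq_sqrt hD0, hnorm, hD]
    nlinarith
  have hfin' := le_of_sq_le_sq hfin (by positivity)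
  refine ⟨hup, hlow.trans ?_, e, heW, hfin'.trans ?_⟩
  · have := mul_nonneg (Real.sqrt_nonneg D) (sq_nonneg ε)
    nlinarith
  · have := mul_nonneg hK0 hε0
    nlinarith

end IsGapAt

end Gap

/-! ### The substitution `U = A ^ (-τ) x` -/

section RitzSystem

variable {E : Type*} [NormedAddCommGroup E] [InnerProductSpace ℂ E] [CompleteSpace E]
  {A : E →ₗ.[ℂ] E} {τ : ℝ}

/-- `⟨A ^ (-τ) x, A ^ (-τ) x'⟩` in `𝓗_{τ - 1/2}` equals `⟨x, T x'⟩`. -/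
lemma powInner_sub_half (hA : IsPosDefSelfAdjoint A) (hτ0 : 0 ≤ τ) (hτ : τ ≤ 1 / 2) (x x' : E) :
    powInner A (τ - 1 / 2) ((boundedInverse A ^ τ) x) ((boundedInverse A ^ τ) x') =
      inner ℂ x (boundedInverse A x') := by
  have hT := hA.boundedInverse_nonneg
  have h12 : (0 : ℝ) ≤ 1 / 2 := by norm_num
  have h1 : ∀ v, powApply A (τ - 1 / 2) ((boundedInverse A ^ τ) v) =
      (boundedInverse A ^ (1 / 2 : ℝ)) v := by
    intro v
    rw [hA.powApply_of_nonpos (by linarith), neg_sub,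
      ← rpow_add_apply hT (by linarith) hτ0, sub_add_cancel]
  rw [powInner, h1, h1, inner_rpow_apply, ← rpow_add_apply hT h12 h12, add_halves,
    CFC.rpow_one _ hT]

lemma powApply_boundedInverse_rpow (hA : IsPosDefSelfAdjoint A) (hτ0 : 0 ≤ τ) (x : E) :
    powApply A τ (boundedInverse A ((boundedInverse A ^ τ) x)) = boundedInverse A x := by
  have hT := hA.boundedInverse_nonneg
  have h1 : boundedInverse A ((boundedInverse A ^ τ) x) =
      (boundedInverse A ^ τ) (boundedInverse A x) := by
    have h2 := rpow_add_apply hT zero_le_one hτ0 x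
    have h3 := rpow_add_apply hT hτ0 zero_le_one x
    rw [CFC.rpow_one _ hT] at h2 h3
    rw [← h2, ← h3, add_comm]
  rw [h1, hA.powApply_rpow hτ0]

lemma ritzLeft_mulVec (hA : IsPosDefSelfAdjoint A) (hτ0 : 0 ≤ τ) (y : ℕ → E) (n : ℕ)
    (X : Fin n → ℂ) (i : Fin n) :
    (ritzLeft A τ (fun k => (boundedInverse A ^ τ) (y k)) n).mulVec X i =
      inner ℂ (y i) (∑ k : Fin n, X k • y k) := by
  rw [inner_sum]
  change ∑ k, _ * X k = _
  refine Finset.sum_congr rfl fun k _ => ?_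
  rw [ritzLeft, Matrix.of_apply, powInner, hA.powApply_rpow hτ0, hA.powApply_rpow hτ0,
    inner_smul_right, mul_comm]

lemma ritzRight_mulVec (hA : IsPosDefSelfAdjoint A) (hτ0 : 0 ≤ τ) (y : ℕ → E) (n : ℕ)
    (X : Fin n → ℂ) (i : Fin n) :
    (ritzRight A τ (fun k => (boundedInverse A ^ τ) (y k)) n).mulVec X i =
      inner ℂ (y i) (boundedInverse A (∑ k : Fin n, X k • y k)) := by
  rw [map_sum, inner_sum]
  change ∑ k, _ * X k = _
  refine Finset.sum_congr rfl fun k _ => ?_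
  rw [ritzRight, Matrix.of_apply, powInner, hA.powApply_rpow hτ0,
    powApply_boundedInverse_rpow hA hτ0, map_smul, inner_smul_right, mul_comm]

/-- The substitution `U = A ^ (-τ) x` turns the Rayleigh–Ritz method for `A` in `𝓗_τ` into the
Rayleigh–Ritz method for the bounded operator `T = A⁻¹` in `𝓗`, with Ritz values `Λ⁻¹`. -/
lemma IsRitzSystem.exists_isRitzPairs (hA : IsPosDefSelfAdjoint A) (hτ0 : 0 ≤ τ) (hτ : τ ≤ 1 / 2)
    {y : ℕ → E} {n : ℕ} {Λ : ℕ → ℝ} {U : ℕ → E}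
    (h : IsRitzSystem A τ (fun k => (boundedInverse A ^ τ) (y k)) n Λ U) :
    ∃ z : Fin n → E, IsRitzPairs (boundedInverse A) (fun i : Fin n => (Λ i)⁻¹) z ∧
      (∀ i : Fin n, 0 < Λ i ∧ U i = (boundedInverse A ^ τ) (((√(Λ i) : ℝ) : ℂ) • z i)) ∧
      Submodule.span ℂ (Set.range z) = Submodule.span ℂ (Set.range fun k : Fin n => y k) := by
  obtain ⟨hmono, horth, heig⟩ := h
  choose X hX1 hX2 using fun i : Fin n => heig i i.2
  set T := boundedInverse A with hTdef
  let x : Fin n → E := fun i => ∑ k : Fin n, X i k • y k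
  have hUx : ∀ i : Fin n, U i = (T ^ τ) (x i) := by
    intro i
    rw [hX1 i]
    simp only [x, map_sum, map_smul]
  have hxT : ∀ i k : Fin n, inner ℂ (x i) (T (x k)) = if i = k then 1 else 0 := by
    intro i k
    have h1 := horth i k i.2 k.2
    rw [hUx, hUx, powInner_sub_half hA hτ0 hτ] at h1
    rw [h1]
    simp only [Fin.ext_iff]
  have hyx : ∀ i k : Fin n, inner ℂ (y i) (x k) = (Λ k : ℂ) * inner ℂ (y i) (T (x k)) := by
    intro i k
    have h1 := congrFun (hX2 k) i
    rw [Pi.smul_apply, ritzLeft_mulVec hA hτ0, ritzRight_mulVec hA hτ0] at h1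
    exact h1
  have hxx : ∀ i k : Fin n, inner ℂ (x i) (x k) = if i = k then (Λ k : ℂ) else 0 := by
    intro i k
    have h1 : inner ℂ (x i) (x k) = (Λ k : ℂ) * inner ℂ (x i) (T (x k)) := by
      simp only [x, sum_inner, inner_smul_left, Finset.mul_sum] at hyx ⊢
      refine Finset.sum_congr rfl fun m _ => ?_
      rw [hyx, mul_left_comm]
    rw [h1, hxT]
    split_ifs <;> simp
  have hΛ : ∀ i : Fin n, 0 < Λ i := by
    intro i
    have h1 : x i ≠ 0 := by
      intro h0
      have h2 := hxT i i
      rw [h0, inner_zero_left, if_pos rfl] at h2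
      exact zero_ne_one h2
    have h2 := hxx i i
    rw [if_pos rfl, inner_self_eq_norm_sq_to_K] at h2
    have h3 : ‖x i‖ ^ 2 = Λ i := Complex.ofReal_injective ((Complex.ofReal_pow _ _).trans h2)
    rw [← h3]
    positivity
  have hs0 : ∀ i : Fin n, ((√(Λ i) : ℝ) : ℂ) ≠ 0 := fun i =>
    Complex.ofReal_ne_zero.2 (Real.sqrt_pos.2 (hΛ i)).ne'
  have hss : ∀ i : Fin n, ((√(Λ i) : ℝ) : ℂ) * ((√(Λ i) : ℝ) : ℂ) = (Λ i : ℂ) := fun i => by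
    rw [← Complex.ofReal_mul, Real.mul_self_sqrt (hΛ i).le]
  let z : Fin n → E := fun i => ((√(Λ i) : ℝ) : ℂ)⁻¹ • x i
  have hz : Orthonormal ℂ z := by
    rw [orthonormal_iff_ite]
    intro i k
    rw [inner_smul_left, inner_smul_right, hxx, map_inv₀, Complex.conj_ofReal]
    split_ifs with hik
    · rw [hik, ← hss k]
      field_simp [hs0 k]
    · simp
  have hzspan : Set.range z ⊆ Submodule.span ℂ (Set.range fun k : Fin n => y k) := by
    rintro _ ⟨i, rfl⟩
    exact Submodule.smul_mem _ _ (Submodule.sum_mem _ fun k _ =>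
      Submodule.smul_mem _ _ (Submodule.subset_span ⟨k, rfl⟩))
  refine ⟨z, ⟨fun i k hik => ?_, hz, fun i k => ?_⟩, fun i => ⟨hΛ i, ?_⟩, ?_⟩
  · exact inv_anti₀ (hΛ i) (hmono i k hik k.2)
  · rw [map_smul, inner_smul_left, inner_smul_right, hxT, map_inv₀, Complex.conj_ofReal]
    split_ifs with hik
    · rw [hik, mul_one, ← mul_inv, hss, Complex.ofReal_inv]
    · simp
  · rw [hUx, smul_inv_smul₀ (hs0 i)]
  · have : FiniteDimensional ℂ (Submodule.span ℂ (Set.range fun k : Fin n => y k)) :=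
      FiniteDimensional.span_of_finite ℂ (Set.finite_range _)
    refine Submodule.eq_of_le_of_finrank_le (Submodule.span_le.2 hzspan) ?_
    rw [finrank_span_eq_card hz.linearIndependent, Fintype.card_fin]
    exact (finrank_range_le_card (R := ℂ) (fun k : Fin n => y k)).trans_eq (Fintype.card_fin n)

/-- The Ritz eigenvalues and eigenvectors exist: they come from an eigenvector basis of the
compression of `T = A⁻¹` to the trial space. -/
lemma exists_isRitzSystem (hA : IsPosDefSelfAdjoint A) (hτ0 : 0 ≤ τ) (hτ : τ ≤ 1 / 2) {y : ℕ → E}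
    (hy : LinearIndependent ℂ y) (n : ℕ) :
    ∃ (Λ : ℕ → ℝ) (U : ℕ → E),
      IsRitzSystem A τ (fun k => (boundedInverse A ^ τ) (y k)) n Λ U := by
  set T := boundedInverse A with hTdef
  have hT : 0 ≤ T := hA.boundedInverse_nonneg
  set Y := Submodule.span ℂ (Set.range fun k : Fin n => y k) with hY
  have : FiniteDimensional ℂ Y := FiniteDimensional.span_of_finite ℂ (Set.finite_range _)
  have hrank : Module.finrank ℂ Y = n := by
    rw [hY]
    exact (finrank_span_eq_card (hy.comp _ Fin.val_injective)).trans (Fintype.card_fin n)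
  have hB := ((nonneg_iff_isPositive T).1 hT).orthogonalProjectionOnto_comp Y
  set B := Y.orthogonalProjectionOnto ∘L T ∘L Y.subtypeL with hBdef
  have hBs : ((B : Y →L[ℂ] Y) : Y →ₗ[ℂ] Y).IsSymmetric := hB.isSymmetric
  let b := hBs.eigenvectorBasis hrank
  let θ := hBs.eigenvalues hrank
  have hbT : ∀ (v : Y) (i : Fin n),
      inner ℂ (v : E) (T (b i)) = (θ i : ℂ) * inner ℂ (v : E) (b i) := by
    intro v i
    have h1 := hBs.apply_eigenvectorBasis hrank i
    have h2 : inner ℂ v (B (b i)) = inner ℂ (v : E) (T (b i)) :=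
      Y.inner_orthogonalProjectionOnto_eq_of_mem_left v _
    rw [← h2]
    have h3 : B (b i) = (θ i : ℂ) • b i := h1
    rw [h3, inner_smul_right]
    rfl
  have hbb : ∀ i k : Fin n, inner ℂ (b i : E) (b k : E) = if i = k then (1 : ℂ) else 0 := fun i k =>
    orthonormal_iff_ite.1 b.orthonormal i k
  have hθ : ∀ i, 0 < θ i := by
    intro i
    have h1 := re_inner_rpow_two_mul hT (s := 1 / 2) (by norm_num) (b i : E)
    rw [mul_one_div_cancel two_ne_zero, CFC.rpow_one T hT, hbT, hbb, if_pos rfl, mul_one,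
      Complex.ofReal_re] at h1
    rw [h1]
    have h2 : (T ^ (1 / 2 : ℝ)) (b i : E) ≠ 0 := by
      intro h0
      have h3 := rpow_injective hT hA.boundedInverse_injective (s := 1 / 2) (by norm_num)
        (h0.trans (map_zero _).symm)
      have h4 := hbb i i
      rw [h3, inner_zero_left, if_pos rfl] at h4
      exact zero_ne_one h4
    positivity
  have hs0 : ∀ i : Fin n, ((√(θ i) : ℝ) : ℂ) ≠ 0 := fun i =>
    Complex.ofReal_ne_zero.2 (Real.sqrt_pos.2 (hθ i)).ne'
  have hss : ∀ i : Fin n, ((√(θ i) : ℝ) : ℂ) * ((√(θ i) : ℝ) : ℂ) = (θ i : ℂ) := fun i => by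
    rw [← Complex.ofReal_mul, Real.mul_self_sqrt (hθ i).le]
  let x : Fin n → E := fun i => ((√(θ i) : ℝ) : ℂ)⁻¹ • (b i : E)
  have hxY : ∀ i, x i ∈ Y := fun i => Y.smul_mem _ (b i).2
  choose X hX using fun i => (Submodule.mem_span_range_iff_exists_fun ℂ).1 (hxY i)
  refine ⟨fun i => if h : i < n then (θ ⟨i, h⟩)⁻¹ else 0,
    fun i => if h : i < n then (T ^ τ) (x ⟨i, h⟩) else 0, ?_, ?_, ?_⟩
  · intro i k hik hk
    simp only [dif_pos hk, dif_pos (hik.trans_lt hk)]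
    exact inv_anti₀ (hθ _) (hBs.eigenvalues_antitone hrank hik)
  · intro i k hi hk
    simp only [dif_pos hi, dif_pos hk]
    rw [powInner_sub_half hA hτ0 hτ]
    simp only [x]
    rw [map_smul, inner_smul_left, inner_smul_right, hbT, hbb, map_inv₀, Complex.conj_ofReal]
    by_cases hik : i = k
    · subst hik
      rw [if_pos rfl, if_pos rfl, mul_one, ← hss]
      field_simp [hs0 ⟨i, hi⟩]
    · rw [if_neg (by simpa using hik), if_neg hik]
      simp
  · intro i hi
    refine ⟨X ⟨i, hi⟩, ?_, funext fun k => ?_⟩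
    · simp only [dif_pos hi]
      rw [← hX ⟨i, hi⟩]
      simp only [map_sum, map_smul]
    · rw [Pi.smul_apply, ritzLeft_mulVec hA hτ0, ritzRight_mulVec hA hτ0, hX]
      simp only [dif_pos hi, x]
      rw [map_smul, inner_smul_right, inner_smul_right,
        hbT ⟨y k, Submodule.subset_span ⟨k, rfl⟩⟩, smul_eq_mul, Complex.ofReal_inv]
      have : ((θ ⟨i, hi⟩ : ℝ) : ℂ) ≠ 0 := Complex.ofReal_ne_zero.2 (hθ _).ne'
      field_simp

end RitzSystem

/-! ### Normalization of the eigenvectors and the asymptotic estimates -/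

section Normalization

/-- If a unit vector `z` has a distance of at most `d` to `e`, then `√Λ z` is close to the multiple
of `e` that has the norm `√ν`. -/
lemma norm_normalized_sub_le {E : Type*} [NormedAddCommGroup E] [InnerProductSpace ℂ E]
    {z e : E} {ν Λ d : ℝ}
    (hν : 0 < ν) (hΛ : 0 < Λ) (hz : ‖z‖ = 1)
    (he : e ≠ 0) (hd : ‖z - e‖ ≤ d) :
    ‖((√ν / ‖e‖ : ℝ) : ℂ) • e - ((√Λ : ℝ) : ℂ) • z‖ ≤ 2 * √ν * d + |Λ - ν| / √ν := by
  have hne : 0 < ‖e‖ := norm_pos_iff.2 he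
  have hsν : 0 < √ν := Real.sqrt_pos.2 hν
  have h1 : ((√ν / ‖e‖ : ℝ) : ℂ) • e - ((√Λ : ℝ) : ℂ) • z =
      ((√ν / ‖e‖ - √ν : ℝ) : ℂ) • e - ((√ν : ℝ) : ℂ) • (z - e) - ((√Λ - √ν : ℝ) : ℂ) • z := by
    push_cast
    module
  have h2 : ‖((√ν / ‖e‖ - √ν : ℝ) : ℂ) • e‖ ≤ √ν * d := by
    rw [norm_smul, Complex.norm_real, Real.norm_eq_abs, ← abs_of_pos hne, ← abs_mul, abs_of_pos hne]
    have h3 : (√ν / ‖e‖ - √ν) * ‖e‖ = √ν * (‖z‖ - ‖e‖) := by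
      rw [hz]; field_simp
    rw [h3, abs_mul, abs_of_pos hsν]
    gcongr
    exact (abs_norm_sub_norm_le z e).trans hd
  have h4 : ‖((√ν : ℝ) : ℂ) • (z - e)‖ ≤ √ν * d := by
    rw [norm_smul, Complex.norm_real, Real.norm_of_nonneg hsν.le]
    gcongr
  have h5 : ‖((√Λ - √ν : ℝ) : ℂ) • z‖ ≤ |Λ - ν| / √ν := by
    rw [norm_smul, Complex.norm_real, Real.norm_eq_abs, hz, mul_one, le_div_iff₀ hsν]
    have h6 : Λ - ν = (√Λ - √ν) * (√Λ + √ν) := by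
      have h7 := Real.sq_sqrt hν.le
      have h8 := Real.sq_sqrt hΛ.le
      nlinarith
    rw [h6, abs_mul, abs_of_pos (by positivity : 0 < √Λ + √ν)]
    have := Real.sqrt_nonneg Λ
    gcongr
    linarith
  rw [h1]
  refine (norm_sub_le _ _).trans ?_
  have := norm_sub_le (((√ν / ‖e‖ - √ν : ℝ) : ℂ) • e) (((√ν : ℝ) : ℂ) • (z - e))
  linarith

variable {E : Type*} [NormedAddCommGroup E] [InnerProductSpace ℂ E] [CompleteSpace E]
  {A : E →ₗ.[ℂ] E} {τ : ℝ}

lemma IsPosDefSelfAdjoint.isClosed_eigenspace (hA : IsPosDefSelfAdjoint A) {ν : ℝ} (hν : ν ≠ 0) :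
    IsClosed (eigenspace A (ν : ℂ) : Set E) := by
  have h1 : (eigenspace A (ν : ℂ) : Set E) = {x | boundedInverse A x = ((ν⁻¹ : ℝ) : ℂ) • x} := by
    ext x
    refine ⟨fun hx => hA.boundedInverse_of_mem_eigenspace hx, fun hx => ?_⟩
    have := hA.mem_eigenspace_of_boundedInverse (inv_ne_zero hν) hx
    rwa [inv_inv] at this
  rw [h1]
  exact isClosed_eq (boundedInverse A).continuous (continuous_const_smul _)

lemma IsLowestEigensystem.exists_isGapAt (hA : IsPosDefSelfAdjoint A) {ℓ : ℕ} {lam : Fin ℓ → ℝ}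
    {u : Fin ℓ → E} (hu : IsLowestEigensystem A ℓ lam u) (j : Fin ℓ) :
    ∃ γ, IsGapAt (boundedInverse A) (fun i => (lam i)⁻¹) u j (eigenspace A (lam j : ℂ)) γ := by
  obtain ⟨γ, hγ, hgap⟩ := hu.exists_gap hA j
  refine ⟨γ, hA.boundedInverse_nonneg, fun i k hik => ?_, hu.orthonormal,
    fun i => hA.boundedInverse_of_mem_eigenspace (hu.eigen i),
    fun w hw => hA.boundedInverse_of_mem_eigenspace hw, fun i hi => ?_, hγ, hgap⟩
  · exact inv_anti₀ (hA.pos_of_mem_eigenspace (hu.eigen i) (hu.orthonormal.ne_zero i))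
      (hu.monotone hik)
  · rw [← inv_injective hi]
    exact hu.eigen i

/-- The vector `A ^ (-τ) (r e)`, `r > 0`, obtained from an eigenvector `e` is normalized in
`𝓗_{τ - 1/2}` if `‖r e‖ = √ν`. -/
lemma exists_normalized_eigenvector (hA : IsPosDefSelfAdjoint A) (hτ0 : 0 ≤ τ) (hτ : τ ≤ 1 / 2)
    {ν : ℝ} {e : E} (he : e ∈ eigenspace A (ν : ℂ)) (he0 : e ≠ 0) :
    (boundedInverse A ^ τ) (((√ν / ‖e‖ : ℝ) : ℂ) • e) ∈ eigenspace A (ν : ℂ) ∧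
      powNorm A (τ - 1 / 2) ((boundedInverse A ^ τ) (((√ν / ‖e‖ : ℝ) : ℂ) • e)) = 1 := by
  have hν := hA.pos_of_mem_eigenspace he he0
  have heT := hA.boundedInverse_of_mem_eigenspace he
  have hne : 0 < ‖e‖ := norm_pos_iff.2 he0
  constructor
  · rw [map_smul, rpow_apply_of_apply_eq_smul hA.boundedInverse_nonneg heT hτ0]
    exact Submodule.smul_mem _ _ (Submodule.smul_mem _ _ he)
  · have h1 := powInner_sub_half hA hτ0 hτ (((√ν / ‖e‖ : ℝ) : ℂ) • e) (((√ν / ‖e‖ : ℝ) : ℂ) • e)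
    have h2 : inner ℂ e e = ((‖e‖ ^ 2 : ℝ) : ℂ) := by
      rw [inner_self_eq_norm_sq_to_K]; exact (Complex.ofReal_pow _ _).symm
    rw [map_smul (boundedInverse A), heT, inner_smul_left, inner_smul_right, inner_smul_right, h2,
      Complex.conj_ofReal, powInner, inner_self_eq_norm_sq_to_K] at h1
    have h3 : √ν / ‖e‖ * (√ν / ‖e‖ * (ν⁻¹ * ‖e‖ ^ 2)) = 1 := by
      field_simp
      exact Real.sq_sqrt hν.le
    have h5 : powNorm A (τ - 1 / 2) ((boundedInverse A ^ τ) (((√ν / ‖e‖ : ℝ) : ℂ) • e)) ^ 2 =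
        1 := by
      refine Eq.trans (Complex.ofReal_injective ?_) h3
      push_cast
      push_cast at h1
      exact h1
    exact (pow_eq_one_iff_of_nonneg (norm_nonneg _) two_ne_zero).1 h5

end Normalization
end FracRitz

open FracRitz in
theorem proposition4p1
    {H G : Type*}
    [NormedAddCommGroup H] [InnerProductSpace ℂ H] [CompleteSpace H]
    [NormedAddCommGroup G] [InnerProductSpace ℂ G] [CompleteSpace G]
    -- `G` is the space `H` with an equivalent Hilbert norm; `J` is the identity map
    (J : G ≃L[ℂ] H)
    (A : H →ₗ.[ℂ] H) (hA : FracRitz.IsPosDefSelfAdjoint A)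
    (ℓ : ℕ) (lam : Fin ℓ → ℝ) (u : Fin ℓ → H) (hu : FracRitz.IsLowestEigensystem A ℓ lam u)
    (M : G →ₗ.[ℂ] G) (hM : FracRitz.IsPosDefSelfAdjoint M)
    (hMc : IsCompactOperator (FracRitz.boundedInverse M))
    (mu : ℕ → ℝ) (q : ℕ → G) (hq : FracRitz.IsEigenEnumeration M mu q)
    -- `𝒟(M^{1/2})` is continuously contained in `𝒟(A^{1/2})`
    (hsub : ∀ v ∈ (FracRitz.fracPow M (1 / 2)).domain, J v ∈ (FracRitz.fracPow A (1 / 2)).domain)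
    (hcont : ∃ c : ℝ, ∀ v ∈ (FracRitz.fracPow M (1 / 2)).domain,
      FracRitz.powNorm A (1 / 2) (J v) ≤ c * FracRitz.powNorm M (1 / 2) v)
    (τ σ : ℝ) (hτ0 : 0 ≤ τ) (hτ : τ ≤ 1 / 2) (hσ : τ ≤ σ)
    (hreg : ∀ i, J.symm (u i) ∈ (FracRitz.fracPow M σ).domain) :
    -- the Ritz eigenvalues and orthonormalized eigenvectors exist for every `n`
    (∀ n, ∃ (Λ : ℕ → ℝ) (U : ℕ → H), FracRitz.IsRitzSystem A τ (fun k => J (q k)) n Λ U) ∧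
    -- and the estimates hold whichever orthonormalized eigenvectors are chosen
    ∀ (Λ : ℕ → ℕ → ℝ) (U : ℕ → ℕ → H),
      (∀ n, FracRitz.IsRitzSystem A τ (fun k => J (q k)) n (Λ n) (U n)) →
      ∀ j : Fin ℓ,
        ((fun n => Λ n j - lam j) =o[atTop] fun n => mu n ^ (2 * τ - 2 * σ)) ∧
        ∃ v : ℕ → H,
          (∀ n, v n ∈ FracRitz.eigenspace A (lam j : ℂ) ∧
            FracRitz.powNorm A (τ - 1 / 2) (v n) = 1) ∧
          (fun n => FracRitz.powNorm A τ (v n - U n j)) =o[atTop]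
            fun n => mu n ^ (τ - σ) := by
  set T := boundedInverse A with hTdef
  have hT : 0 ≤ T := hA.boundedInverse_nonneg
  have hTinj : Function.Injective (T ^ τ) := rpow_injective hT hA.boundedInverse_injective hτ0
  obtain ⟨C₀, hC₀, hheinz⟩ :=
    exists_rpow_eq_of_fracPow_half_le hA hM (J : G →L[ℂ] H) hsub hcont hτ0 hτ
  -- the trial vectors are `A ^ (-τ) (y k)`
  have hqy : ∀ k, ∃ y, (T ^ τ) y = J (q k) := by
    intro k
    obtain ⟨y, hy, -⟩ := hheinz (((mu k ^ τ : ℝ) : ℂ) • q k)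
    refine ⟨y, ?_⟩
    rw [hy, map_smul, hq.rpow_apply hM hτ0, smul_smul, ← Complex.ofReal_mul,
      ← Real.rpow_add (hq.mu_pos hM k), add_neg_cancel, Real.rpow_zero, Complex.ofReal_one,
      one_smul]
    rfl
  choose y hy using hqy
  have hw : (fun k => J (q k)) = fun k => (T ^ τ) (y k) := funext fun k => (hy k).symm
  rw [hw]
  have hyind : LinearIndependent ℂ y := by
    have h1 : LinearIndependent ℂ (fun k => J (q k)) :=
      hq.orthonormal.linearIndependent.map' (J : G →ₗ[ℂ] H)
        (LinearMap.ker_eq_bot.2 J.injective)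
    rw [hw] at h1
    exact LinearIndependent.of_comp ((T ^ τ : H →L[ℂ] H) : H →ₗ[ℂ] H) h1
  refine ⟨exists_isRitzSystem hA hτ0 hτ hyind, fun Λ U hΛU j => ?_⟩
  have hlam : ∀ i, 0 < lam i := fun i =>
    hA.pos_of_mem_eigenspace (hu.eigen i) (hu.orthonormal.ne_zero i)
  set f : ℕ → ℝ := fun n => mu n ^ (τ - σ) with hf
  have hmu := hq.mu_pos hM
  -- the distance of the eigenvectors `u i` to the trial spaces
  have hdist : ∀ i, ∃ d : ℕ → ℝ, d =o[atTop] f ∧ ∀ n, 0 ≤ d n ∧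
      ∃ w ∈ Submodule.span ℂ (Set.range fun k : Fin n => y k), ‖u i - w‖ ≤ d n := by
    intro i
    obtain ⟨c, g, hcg, hgo⟩ := hq.exists_approx hM hMc hτ0 hσ (hreg i)
    choose r hr hrn using fun n => hheinz (g n)
    have hri : ∀ n, r n = ((lam i ^ τ : ℝ) : ℂ) • u i - ∑ k ∈ Finset.range n, c k • y k := by
      intro n
      apply hTinj
      have h1 : (T ^ τ) (u i) = (((lam i)⁻¹ ^ τ : ℝ) : ℂ) • u i :=
        rpow_apply_of_apply_eq_smul hT (hA.boundedInverse_of_mem_eigenspace (hu.eigen i)) hτ0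
      have h2 : lam i ^ τ * (lam i)⁻¹ ^ τ = 1 := by
        rw [← Real.mul_rpow (hlam i).le (inv_nonneg.2 (hlam i).le), mul_inv_cancel₀ (hlam i).ne',
          Real.one_rpow]
      rw [hr, hcg, map_sub, map_sub, map_smul, h1, smul_smul, ← Complex.ofReal_mul, h2,
        Complex.ofReal_one, one_smul, map_sum, map_sum]
      simp only [map_smul, hy]
      simp
    have hpos : 0 < lam i ^ τ := Real.rpow_pos_of_pos (hlam i) _
    refine ⟨fun n => (lam i ^ τ)⁻¹ * (C₀ * ‖g n‖),
      (hgo.norm_left.const_mul_left C₀).const_mul_left _,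
      fun n => ⟨by positivity, ((lam i ^ τ : ℝ) : ℂ)⁻¹ • ∑ k ∈ Finset.range n, c k • y k, ?_, ?_⟩⟩
    · refine Submodule.smul_mem _ _ (Submodule.sum_mem _ fun k hk => Submodule.smul_mem _ _ ?_)
      exact Submodule.subset_span ⟨⟨k, Finset.mem_range.1 hk⟩, rfl⟩
    · have h1 : u i - ((lam i ^ τ : ℝ) : ℂ)⁻¹ • ∑ k ∈ Finset.range n, c k • y k =
          ((lam i ^ τ : ℝ) : ℂ)⁻¹ • r n := by
        rw [hri, smul_sub, inv_smul_smul₀ (Complex.ofReal_ne_zero.2 hpos.ne')]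
      rw [h1, norm_smul, norm_inv, Complex.norm_real, Real.norm_of_nonneg hpos.le]
      exact mul_le_mul_of_nonneg_left (hrn n) (by positivity)
  choose d hdo hd using hdist
  set ε : ℕ → ℝ := fun n => ∑ i, d i n with hε
  have hεo : ε =o[atTop] f := IsLittleO.fun_sum fun i _ => hdo i
  have hεlim : Tendsto ε atTop (𝓝 0) := by
    have h1 : f =O[atTop] (fun _ => (1 : ℝ)) := by
      refine IsBigO.of_bound (mu 0 ^ (τ - σ)) (Eventually.of_forall fun n => ?_)
      rw [Real.norm_of_nonneg (Real.rpow_nonneg (hmu n).le _), norm_one, mul_one]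
      exact Real.rpow_le_rpow_of_nonpos (hmu 0) (hq.monotone (Nat.zero_le n)) (by linarith)
    exact (isLittleO_one_iff ℝ).1 (hεo.trans_isBigO h1)
  have hεsq : (fun n => ε n ^ 2) =o[atTop] fun n => mu n ^ (2 * τ - 2 * σ) := by
    have h1 := hεo.pow two_pos
    refine h1.congr_right fun n => ?_
    rw [hf, ← Real.rpow_natCast, ← Real.rpow_mul (hmu n).le]
    congr 1
    push_cast
    ring
  set W := eigenspace A (lam j : ℂ) with hW
  have : CompleteSpace W := (hA.isClosed_eigenspace (hlam j).ne').completeSpace_coe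
  obtain ⟨γ, hγ⟩ := hu.exists_isGapAt hA j
  obtain ⟨C, δ, hδ, hbound⟩ := hγ.exists_ritz_bound
  choose z hzR hzU hzspan using fun n => (hΛU n).exists_isRitzPairs hA hτ0 hτ
  -- the bounds hold for all large `n`
  have hev : ∀ᶠ n in atTop, (j : ℕ) < n ∧ ε n ≤ δ ∧ C * ε n ^ 2 ≤ (lam j)⁻¹ / 2 ∧ C * ε n < 1 := by
    have h1 : Tendsto (fun n => C * ε n ^ 2) atTop (𝓝 0) := by
      simpa using (hεlim.pow 2).const_mul C
    have h2 : Tendsto (fun n => C * ε n) atTop (𝓝 0) := by simpa using hεlim.const_mul C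
    filter_upwards [eventually_gt_atTop (j : ℕ), hεlim.eventually_le_const hδ,
      h1.eventually_le_const (half_pos (inv_pos.2 (hlam j))), h2.eventually_lt_const one_pos] with
      n h3 h4 h5 h6
    exact ⟨h3, h4, h5, h6⟩
  have hmain : ∀ n (hj : (j : ℕ) < n), ε n ≤ δ → C * ε n ^ 2 ≤ (lam j)⁻¹ / 2 →
      |Λ n j - lam j| ≤ 2 * lam j ^ 2 * C * ε n ^ 2 ∧
        ∃ e ∈ W, ‖z n ⟨j, hj⟩ - e‖ ≤ C * ε n := by
    intro n hj hn1 hn2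
    obtain ⟨h1, h2, h3⟩ := hbound n _ (z n) hj (ε n) (hzR n) hn1 (fun i => by
      obtain ⟨h0, w, hw1, hw2⟩ := hd i n
      rw [hzspan]
      exact ⟨w, hw1, hw2.trans (Finset.single_le_sum (f := fun i => d i n)
        (fun i _ => (hd i n).1) (Finset.mem_univ i))⟩)
    refine ⟨?_, h3⟩
    obtain ⟨hΛ0, -⟩ := hzU n ⟨j, hj⟩
    simp only at h1 h2 hΛ0
    have hl := hlam j
    have h4 : lam j ≤ Λ n j := (inv_le_inv₀ hΛ0 hl).1 h1
    have h5 : Λ n j ≤ 2 * lam j := by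
      have h6 : (lam j)⁻¹ / 2 ≤ (Λ n j)⁻¹ := by linarith
      have h7 : (2 * lam j)⁻¹ ≤ (Λ n j)⁻¹ := by rw [mul_inv]; linarith
      exact (inv_le_inv₀ (by positivity) hΛ0).1 h7
    have h8 : Λ n j - lam j = Λ n j * lam j * ((lam j)⁻¹ - (Λ n j)⁻¹) := by
      field_simp
    rw [abs_of_nonneg (by linarith), h8]
    have h9 : 0 ≤ (lam j)⁻¹ - (Λ n j)⁻¹ := by linarith
    calc Λ n j * lam j * ((lam j)⁻¹ - (Λ n j)⁻¹) ≤ 2 * lam j * lam j * (C * ε n ^ 2) := by gcongr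
      _ = _ := by ring
  have hΛO : (fun n => Λ n j - lam j) =O[atTop] fun n => ε n ^ 2 := by
    refine IsBigO.of_bound (2 * lam j ^ 2 * C) ?_
    filter_upwards [hev] with n hn
    obtain ⟨h1, h2, h3, -⟩ := hn
    rw [Real.norm_eq_abs, Real.norm_of_nonneg (sq_nonneg _)]
    exact (hmain n h1 h2 h3).1
  refine ⟨hΛO.trans_isLittleO hεsq, ?_⟩
  -- for the finitely many remaining `n`, any normalized eigenvector will do
  have hex : ∀ n, ∃ v, (v ∈ W ∧ powNorm A (τ - 1 / 2) v = 1) ∧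
      ((j : ℕ) < n ∧ ε n ≤ δ ∧ C * ε n ^ 2 ≤ (lam j)⁻¹ / 2 ∧ C * ε n < 1 →
        powNorm A τ (v - U n j) ≤ 2 * √(lam j) * (C * ε n) + |Λ n j - lam j| / √(lam j)) := by
    intro n
    by_cases hn : (j : ℕ) < n ∧ ε n ≤ δ ∧ C * ε n ^ 2 ≤ (lam j)⁻¹ / 2 ∧ C * ε n < 1
    · obtain ⟨hj, h1, h2, h3⟩ := hn
      obtain ⟨-, e, heW, hez⟩ := hmain n hj h1 h2
      have hz1 : ‖z n ⟨j, hj⟩‖ = 1 := (hzR n).orthonormal.1 _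
      have he0 : e ≠ 0 := by
        rintro rfl
        rw [sub_zero, hz1] at hez
        linarith
      refine ⟨_, exists_normalized_eigenvector hA hτ0 hτ heW he0, fun _ => ?_⟩
      obtain ⟨hΛ0, hUz⟩ := hzU n ⟨j, hj⟩
      simp only at hUz hΛ0
      rw [hUz, ← map_sub, powNorm, hA.powApply_rpow hτ0]
      exact norm_normalized_sub_le (hlam j) hΛ0 hz1 he0 hez
    · exact ⟨_, exists_normalized_eigenvector hA hτ0 hτ (hu.eigen j) (hu.orthonormal.ne_zero j),
        fun h => absurd h hn⟩
  choose v hv hvb using hex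
  refine ⟨v, hv, ?_⟩
  have h1 : (fun n => powNorm A τ (v n - U n j)) =O[atTop]
      fun n => 2 * √(lam j) * (C * ε n) + |Λ n j - lam j| / √(lam j) := by
    refine IsBigO.of_bound 1 ?_
    filter_upwards [hev] with n hn
    rw [one_mul, Real.norm_of_nonneg (show 0 ≤ powNorm A τ (v n - U n j) from norm_nonneg _)]
    exact (hvb n hn).trans (le_abs_self _)
  have h2 : (fun n => |Λ n j - lam j| / √(lam j)) =o[atTop] f := by
    have h3 : (fun n => ε n ^ 2) =o[atTop] f := by
      have h4 := hεo.mul ((isLittleO_one_iff ℝ).2 hεlim)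
      simpa [sq] using h4
    have h5 := ((hΛO.trans_isLittleO h3).norm_left).const_mul_left (√(lam j))⁻¹
    refine h5.congr_left fun n => ?_
    rw [Real.norm_eq_abs, div_eq_inv_mul]
  exact h1.trans_isLittleO (((hεo.const_mul_left C).const_mul_left _).add h2)
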